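/- For $k\ge 1$, a finite metric space $(X,d)$ is a $k$-HST if there is a finite rooted tree $T$ whose leaves are identified with the points of $X$, together with labels $\Delta(u)\ge 0$ of its vertices, such that $\Delta(u)=0$ if and only if $u$ is a leaf, $\Delta(u)\le \Delta(v)/k$ whenever $u$ is a child of $v$, and $d(x,y)=\Delta(\mathrm{lca}(x,y))$ for all $x,y\in X$, where $\mathrm{lca}$ is the least common ancestor in $T$. In the metrical task system (MTS) on $X$, a task is a function $\tau:X\to[0,\infty]$; an algorithm occupying $x$ serves $\tau$ by moving to some $y\in X$ (possibly $y=x$) at cost $d(x,y)+\tau(y)$, and its cost on a finite task sequence $\sigma$ is the sum of these costs. Let $\mathrm{cost}_{\mathrm{OPT}}(\sigma)$ be the minimum cost of serving $\sigma$ offline from a given initial state $x_0$. A randomized online algorithm $A$ starts at $x_0$ and chooses each state from the tasks seen so far (including the current one) and its random bits; it is $r$-competitive against an oblivious adversary if there is a constant $a$ such that $\mathrm{E}[\mathrm{cost}_A(\sigma)]\le r\cdot\mathrm{cost}_{\mathrm{OPT}}(\sigma)+a$ for every finite task sequence $\sigma$. Theorem. There are universal constants $C,c>0$ such that the following holds.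 Let $X$ be a $k$-HST on $n$ points with $k\ge 1$ and $k\ge C\log^2 n$, and let $x_0\in X$. If a randomized online algorithm for the MTS on $X$ with initial state $x_0$ is $r$-competitive against an oblivious adversary, then $r\ge c\log n$. -/

import Mathlib

open scoped ENNReal NNReal

universe u v

/-- A finite metric space `X` is a `k`-HST if it is isometric to the set of leaves of a finite
rooted tree `T` with vertex labels `Δ`. In Mathlib's `RootedTree` the root is `⊥`, `v ≤ w` says
that `v` is an ancestor of `w`, `v ⋖ w` says that `w` is a child of `v`, the leaves are the
maximal vertices, and `v ⊓ w` is the least common ancestor of `v` and `w`. -/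
def IsHST (k : ℝ) (X : Type u) [MetricSpace X] : Prop :=
  ∃ (T : RootedTree.{0}) (Δ : T → ℝ) (leaf : X ≃ {w : T // IsMax w}),
    Finite T ∧
    (∀ w, 0 ≤ Δ w) ∧
    (∀ w, Δ w = 0 ↔ IsMax w) ∧
    (∀ v w : T, v ⋖ w → Δ w ≤ Δ v / k) ∧
    ∀ x y : X, dist x y = Δ ((leaf x : T) ⊓ (leaf y : T))

/-- A task assigns to every point a cost in `[0, ∞]`. -/
abbrev MTSTask (X : Type u) : Type u := X → ℝ≥0∞

/-- Cost of serving `σ` along the states `s 0, s 1, …`: the `i`-th task (counted from `0`) is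
served by moving from `s i` to `s (i + 1)` and paying the cost of the task at `s (i + 1)`. -/
noncomputable def serviceCost {X : Type u} [MetricSpace X] (σ : List (MTSTask X)) (s : ℕ → X) :
    ℝ≥0∞ :=
  ∑ i : Fin σ.length, (edist (s i) (s (i + 1)) + σ.get i (s (i + 1)))

/-- The optimal offline cost of serving `σ` from the initial state `x₀`. -/
noncomputable def optCost {X : Type u} [MetricSpace X] (x₀ : X) (σ : List (MTSTask X)) : ℝ≥0∞ :=
  ⨅ (s : ℕ → X) (_ : s 0 = x₀), serviceCost σ s

/-- A randomized online algorithm with initial state `x₀`: for each random seed `ω`, the state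
occupied after a list of tasks is a function of that list (the tasks seen so far). -/
structure RandomizedOnlineAlgorithm (X : Type u) (x₀ : X) where
  /-- the space of random seeds -/
  Ω : Type v
  [measurableSpace : MeasurableSpace Ω]
  /-- the distribution of the random seed -/
  μ : MeasureTheory.Measure Ω
  [isProbabilityMeasure : MeasureTheory.IsProbabilityMeasure μ]
  /-- the state occupied after the tasks seen so far -/
  state : Ω → List (MTSTask X) → X
  state_nil : ∀ ω, state ω [] = x₀
  measurableSet_state : ∀ (h : List (MTSTask X)) (x : X), MeasurableSet {ω | state ω h = x}

namespace RandomizedOnlineAlgorithm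

attribute [instance] measurableSpace isProbabilityMeasure

variable {X : Type u} [MetricSpace X] {x₀ : X}

/-- The expected cost of the algorithm on a task sequence. -/
noncomputable def expectedCost (A : RandomizedOnlineAlgorithm.{u, v} X x₀)
    (σ : List (MTSTask X)) : ℝ≥0∞ :=
  ∫⁻ ω, serviceCost σ (fun i => A.state ω (σ.take i)) ∂A.μ

/-- The algorithm is `r`-competitive against an oblivious adversary. -/
def IsCompetitive (A : RandomizedOnlineAlgorithm.{u, v} X x₀) (r : ℝ≥0) : Prop :=
  ∃ c : ℝ≥0, ∀ σ : List (MTSTask X), A.expectedCost σ ≤ r * optCost x₀ σ + c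

end RandomizedOnlineAlgorithm

set_option linter.unusedSectionVars false

/-! An adversary is built by recursion over the tree. It may consult the distribution of the online
algorithm, since a task sequence determines that distribution, but never the random bits. It
maintains upper bounds for the work function. A potential that is 1-Lipschitz for transport of mass
certifies that each unit of `level` costs the algorithm at least `R` per unit of mass. The offline
cost is at most `level` plus a constant, and `level` grows without bound, so `R` bounds the
competitive ratio (`HasAdversary.le_of_isCompetitive`).

At a vertex with label `D` the subtrees of the children behave like points at mutual distance `D`,
with raising the level of part `i` costing `R i` per unit of mass there. A `StarPotential`
prescribes an ideal distribution over the parts as a function of their levels. The adversary always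
plays in the part whose mass exceeds the prescription most (`exists_comb_step`). A part whose level
is `D` above another is forbidden and restarted. Child potentials change by at most `K ≤ D / 4` per
unit of mass, so `M = D - 2 * K ≥ D / 2` of the distance between parts is left to pay for deviations
from the prescription. This is where the separation `k` enters.

Two star potentials are used. With `b` parts of ratio `r`, the soft minimum gives `r + log b / 32`.
With two parts of ratios `R₁ ≥ R₂`, an exponential gives `R₁ + exp (-4 * (R₁ - R₂ + 1))`. By
`exists_many_or_two`, after sorting the parts by size, one of these choices preserves the ratio `log
(size) / 128`; the remaining parts are abandoned. Potentials stay below `4 * (log n + 1) * Δ v`, so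
a separation of order `log n` suffices. -/

/-! ### Recursive adversaries -/

/-- A recursive adversary strategy on the point set `S`. In state `s` it forbids the points of
`evac s`, whereupon `s` becomes `settle s`, and then charges `ε` at one point of `S`. The function
`work s` bounds the work function from above and `level s` bounds its minimum; `pot s` is a
potential of the distribution of the online algorithm, in terms of which the online cost per unit
of increase of the level and unit of mass is at least `R`. -/
structure Adversary {X : Type u} [MetricSpace X] [DecidableEq X] (S : Finset X) (ε R K : ℝ) where
  State : Type
  gain : ℝ
  gain_pos : 0 < gain
  evac : State → Set X
  level : State → ℝ
  work : State → X → ℝ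
  pot : State → (X → ℝ) → ℝ
  fresh : ℝ → State
  settle : State → State
  level_fresh : ∀ a, level (fresh a) = a
  work_fresh : ∀ a, ∀ x ∈ S, work (fresh a) x = a
  exists_work_le : ∀ s, ∃ y ∈ S, y ∉ evac s ∧ work s y ≤ level s
  pot_congr : ∀ s (p q : X → ℝ), (∀ x ∈ S, p x = q x) → pot s p = pot s q
  pot_zero : ∀ s, pot s 0 = 0
  -- Movement pays for any increase of the potential that it causes.
  pot_move : ∀ s (p : X → ℝ), (∀ x, 0 ≤ p x) → ∀ x ∈ S, ∀ y ∈ S, ∀ a : ℝ, 0 ≤ a →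
    pot s (p + (Pi.single y a : X → ℝ)) - pot s (p + (Pi.single x a : X → ℝ)) ≤ a * dist x y
  pot_add : ∀ s (p : X → ℝ), (∀ x, 0 ≤ p x) → ∀ x ∈ S, ∀ a : ℝ, 0 ≤ a →
    |pot s (p + (Pi.single x a : X → ℝ)) - pot s p| ≤ a * K
  level_settle : ∀ s, level (settle s) = level s
  pot_settle : ∀ s (p : X → ℝ), (∀ x ∈ S, x ∈ evac s → p x = 0) → pot (settle s) p = pot s p
  work_settle : ∀ s, ∀ x ∈ S, ∃ y ∈ S, y ∉ evac s ∧ work s y + dist y x ≤ work (settle s) x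
  -- The charge `ε * p l` pays for the rise of the level and the change of potential. The mass of
  -- `p` is arbitrary because a sub-adversary sees only the mass of its own part.
  step : ∀ s (p : X → ℝ), (∀ x, 0 ≤ p x) → (∀ x ∈ S, x ∈ evac s → p x = 0) → ∃ l ∈ S, ∃ s',
    gain ≤ level s' - level s ∧ level s' - level s ≤ ε ∧
    R * (∑ x ∈ S, p x) * (level s' - level s) + pot s' p - pot s p ≤ ε * p l ∧
    ∀ x ∈ S, work (settle s) x + (if x = l then ε else 0) ≤ work s' x

namespace Adversary

variable {X : Type u} [MetricSpace X] [DecidableEq X]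

/-- The adversary on a single point. -/
def singleton (x : X) {ε : ℝ} (hε : 0 < ε) : Adversary {x} ε 0 0 where
  State := ℝ
  gain := ε
  gain_pos := hε
  evac _ := ∅
  level s := s
  work s _ := s
  pot _ _ := 0
  fresh a := a
  settle s := s
  level_fresh _ := rfl
  work_fresh _ _ _ := rfl
  exists_work_le s := ⟨x, by simp, by simp, le_rfl⟩
  pot_congr _ _ _ _ := rfl
  pot_zero _ := rfl
  pot_move s p _ x _ y _ a ha := by simpa using mul_nonneg ha dist_nonneg
  pot_add s p _ x _ a ha := by simp
  level_settle _ := rfl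
  pot_settle _ _ _ := rfl
  work_settle s y hy := ⟨y, hy, by simp, by simp⟩
  step s p hp _ := ⟨x, by simp, s + ε, by simp, by simp, by simpa using mul_nonneg hε.le (hp x), by
    intro y hy
    simp [Finset.mem_singleton.1 hy]⟩

/-- An adversary stays valid for smaller ratios and larger potential bounds. -/
def mono {S : Finset X} {ε R R' K K' : ℝ} (A : Adversary S ε R K) (hR : R' ≤ R) (hK : K ≤ K') :
    Adversary S ε R' K' where
  State := A.State
  gain := A.gain
  gain_pos := A.gain_pos
  evac := A.evac
  level := A.level
  work := A.work
  pot := A.pot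
  fresh := A.fresh
  settle := A.settle
  level_fresh := A.level_fresh
  work_fresh := A.work_fresh
  exists_work_le := A.exists_work_le
  pot_congr := A.pot_congr
  pot_zero := A.pot_zero
  pot_move := A.pot_move
  pot_add s p hp x hx a ha := (A.pot_add s p hp x hx a ha).trans (mul_le_mul_of_nonneg_left hK ha)
  level_settle := A.level_settle
  pot_settle := A.pot_settle
  work_settle := A.work_settle
  step s p hp h0 := by
    obtain ⟨l, hl, s', h1, h2, h3, h4⟩ := A.step s p hp h0
    refine ⟨l, hl, s', h1, h2, le_trans ?_ h3, h4⟩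
    have hm : 0 ≤ ∑ x ∈ S, p x := Finset.sum_nonneg fun x _ => hp x
    have : 0 ≤ A.level s' - A.level s := A.gain_pos.le.trans h1
    gcongr

end Adversary

theorem sum_add_single {X : Type u} [DecidableEq X] (S : Finset X) (p : X → ℝ) (x : X) (a : ℝ) :
    ∑ z ∈ S, (p + (Pi.single x a : X → ℝ)) z = ∑ z ∈ S, p z + if x ∈ S then a else 0 := by
  simp [Finset.sum_add_distrib, Pi.single_apply]

/-! ### Combining adversaries on equidistant parts -/

/-- Disjoint finite sets `S i` at mutual distance `D`, with union `T`; `idx` tells the part of a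
point. -/
structure EquidistantParts {X : Type u} [MetricSpace X] {ι : Type} (T : Finset X)
    (S : ι → Finset X) (idx : X → ι) (D : ℝ) : Prop where
  subset : ∀ i, S i ⊆ T
  mem_idx : ∀ x ∈ T, x ∈ S (idx x)
  idx_eq : ∀ i, ∀ x ∈ S i, idx x = i
  dist_eq : ∀ x ∈ T, ∀ y ∈ T, idx x ≠ idx y → dist x y = D

theorem EquidistantParts.sum_eq {X : Type u} [MetricSpace X] {ι : Type} [Fintype ι]
    {T : Finset X} {S : ι → Finset X} {idx : X → ι} {D : ℝ} (h : EquidistantParts T S idx D)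
    (f : X → ℝ) : ∑ x ∈ T, f x = ∑ i, ∑ x ∈ S i, f x := by
  classical
  rw [← Finset.sum_biUnion]
  · congr 1
    ext x
    simp only [Finset.mem_biUnion, Finset.mem_univ, true_and]
    exact ⟨fun hx => ⟨_, h.mem_idx x hx⟩, fun ⟨i, hi⟩ => h.subset i hi⟩
  · intro i _ j _ hij
    rw [Function.onFun, Finset.disjoint_left]
    intro x hx hj
    exact hij ((h.idx_eq i x hx).symm.trans (h.idx_eq j x hj))

/-- A potential for the metrical task system on `ι` points at mutual distance `D` in which the
online cost at the point `i` is multiplied by `R i`, with movement cost `M`. -/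
structure StarPotential {ι : Type} [Fintype ι] [DecidableEq ι] (R : ι → ℝ) (ρ D M ε B : ℝ) where
  val : (ι → ℝ) → ℝ
  prob : (ι → ℝ) → ι → ℝ
  prob_pos : ∀ w, (∀ i j, w i ≤ w j + (D + ε)) → ∀ i, 0 < prob w i
  sum_prob : ∀ w, ∑ i, prob w i = 1
  -- The right side is the cost on the prescribed mass at `i`, plus `M` for the mass that the new
  -- prescription withdraws from `i`.
  val_sub_le : ∀ w, (∀ i j, w i ≤ w j + (D + ε)) → ∀ i, ∀ h, 0 ≤ h → h ≤ ε →
    val (Function.update w i (w i + h)) - val w ≤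
      R i * prob w i * h + M * (prob w i - prob (Function.update w i (w i + h)) i)
  abs_val_le : ∀ w, (∀ i j, w i ≤ w j + (D + ε)) →
    |val w - ρ * ((∑ i, w i) / Fintype.card ι)| ≤ B

namespace Adversary

variable {X : Type u} [MetricSpace X] [DecidableEq X]

section combine

variable {ι : Type} {S : ι → Finset X} {R : ι → ℝ} {ε K ρ D M B : ℝ}

/-- The states of a combination of adversaries. -/
def CombState (A : ∀ i, Adversary (S i) ε (R i) K) (D : ℝ) : Type :=
  -- Only parts less than `D` above every other are raised, and by at most `ε`; hence the spread `D
  -- + ε`.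
  {f : ∀ i, (A i).State // ∀ i j, (A i).level (f i) ≤ (A j).level (f j) + (D + ε)}

/-- The vector of levels. -/
def levels {A : ∀ i, Adversary (S i) ε (R i) K} (s : CombState A D) (i : ι) : ℝ :=
  (A i).level (s.1 i)

/-- The parts whose level exceeds some other one by `D`. -/
def Saturated {A : ∀ i, Adversary (S i) ε (R i) K} (s : CombState A D) (i : ι) : Prop :=
  ∃ j, levels s j + D ≤ levels s i

open Classical in
/-- Evacuated states of a combination. -/
noncomputable def combSettle {A : ∀ i, Adversary (S i) ε (R i) K} (s : CombState A D) :
    ∀ i, (A i).State := fun i =>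
  -- All points of a saturated part are reachable from a cheapest part at cost at most the level of
  -- the saturated one, so play there can restart with a constant work function.
  if Saturated s i then (A i).fresh (levels s i) else (A i).settle (s.1 i)

theorem level_combSettle {A : ∀ i, Adversary (S i) ε (R i) K} (s : CombState A D) (i : ι) :
    (A i).level (combSettle s i) = levels s i := by
  unfold combSettle
  split_ifs
  · exact (A i).level_fresh _
  · exact (A i).level_settle _

variable [Fintype ι] [DecidableEq ι] [Nonempty ι]

/-- The excess of the mass of the most overloaded part. -/
noncomputable def excess (S : ι → Finset X) (y : ι → ℝ) (p : X → ℝ) : ℝ :=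
  Finset.univ.sup' Finset.univ_nonempty
    fun i => ∑ x ∈ S i, p x - (∑ j, ∑ x ∈ S j, p x) * y i

theorem excess_le_add {X : Type u} {ι : Type} [Fintype ι] [Nonempty ι] {S : ι → Finset X} {y : ι → ℝ} {p q : X → ℝ} {a : ℝ}
    (h : ∀ i, (∑ x ∈ S i, p x - (∑ j, ∑ x ∈ S j, p x) * y i) ≤
      (∑ x ∈ S i, q x - (∑ j, ∑ x ∈ S j, q x) * y i) + a) :
    excess S y p ≤ excess S y q + a := by
  refine Finset.sup'_le _ _ fun i _ => (h i).trans ?_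
  gcongr
  exact Finset.le_sup' (fun i => ∑ x ∈ S i, q x - (∑ j, ∑ x ∈ S j, q x) * y i) (Finset.mem_univ i)

/-- The potential of a combination. -/
noncomputable def combPot {A : ∀ i, Adversary (S i) ε (R i) K} (P : StarPotential R ρ D M ε B)
    (s : CombState A D) (p : X → ℝ) : ℝ :=
  -- The three terms account for play inside the parts, for the prescribed distribution over the
  -- parts, and for the deviation from it.
  ∑ i, (A i).pot (s.1 i) p +
    (∑ i, ∑ x ∈ S i, p x) * (P.val (levels s) - ρ * ((∑ i, levels s i) / Fintype.card ι)) -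
    M * excess S (P.prob (levels s)) p

theorem excess_add_single {T : Finset X} {idx : X → ι} (hT : EquidistantParts T S idx D)
    {y : ι → ℝ} (hy : ∀ i, 0 ≤ y i) (hy' : ∀ i, y i ≤ 1) (p : X → ℝ) {x : X} (hx : x ∈ T) {a : ℝ}
    (ha : 0 ≤ a) : |excess S y (p + (Pi.single x a : X → ℝ)) - excess S y p| ≤ a := by
  have hm : ∑ i, (if x ∈ S i then a else 0) = a := by
    rw [Finset.sum_eq_single (idx x)]
    · simp [hT.mem_idx x hx]
    · intro i _ hi
      rw [if_neg fun h => hi (hT.idx_eq i x h).symm]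
    · simp
  rw [abs_le]
  constructor
  · have := excess_le_add (S := S) (y := y) (p := p) (q := p + (Pi.single x a : X → ℝ)) (a := a) (by
      intro i
      simp only [sum_add_single, Finset.sum_add_distrib, hm]
      have := mul_le_mul_of_nonneg_left (hy' i) ha
      split_ifs <;> nlinarith [mul_nonneg ha (hy i)])
    linarith
  · have := excess_le_add (S := S) (y := y) (p := p + (Pi.single x a : X → ℝ)) (q := p) (a := a) (by
      intro i
      simp only [sum_add_single, Finset.sum_add_distrib, hm]
      split_ifs <;> nlinarith [mul_nonneg ha (hy i)])
    linarith

theorem excess_move {T : Finset X} {idx : X → ι} (hT : EquidistantParts T S idx D)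
    (y : ι → ℝ) (p : X → ℝ) {x x' : X} (hx : x ∈ T) (hx' : x' ∈ T) {a : ℝ} (ha : 0 ≤ a) :
    excess S y (p + (Pi.single x a : X → ℝ)) ≤ excess S y (p + (Pi.single x' a : X → ℝ)) + a := by
  have hm : ∀ z ∈ T, ∑ i, (if z ∈ S i then a else 0) = a := by
    intro z hz
    rw [Finset.sum_eq_single (idx z)]
    · simp [hT.mem_idx z hz]
    · intro i _ hi
      rw [if_neg fun h => hi (hT.idx_eq i z h).symm]
    · simp
  apply excess_le_add
  intro i
  simp only [sum_add_single, Finset.sum_add_distrib, hm x hx, hm x' hx']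
  split_ifs <;> linarith

theorem mem_parts_iff {T : Finset X} {idx : X → ι} (hT : EquidistantParts T S idx D)
    {x : X} (hx : x ∈ T) {i : ι} : x ∈ S i ↔ i = idx x :=
  ⟨fun h => (hT.idx_eq i x h).symm, fun h => h ▸ hT.mem_idx x hx⟩

theorem sum_pot_add_single {A : ∀ i, Adversary (S i) ε (R i) K} {T : Finset X} {idx : X → ι}
    (hT : EquidistantParts T S idx D) (s : ∀ i, (A i).State) (p : X → ℝ) (x : X)
    (a : ℝ) : ∑ i, (A i).pot (s i) (p + (Pi.single x a : X → ℝ)) = ∑ i, (A i).pot (s i) p +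
      ((A (idx x)).pot (s (idx x)) (p + (Pi.single x a : X → ℝ)) -
        (A (idx x)).pot (s (idx x)) p) := by
  rw [← sub_eq_iff_eq_add', ← Finset.sum_sub_distrib, Finset.sum_eq_single (idx x)]
  · intro i _ hi
    rw [sub_eq_zero]
    apply (A i).pot_congr
    intro z hz
    have : z ≠ x := fun h => hi ((hT.idx_eq i z hz).symm.trans (h ▸ rfl))
    simp [this]
  · simp

variable {A : ∀ i, Adversary (S i) ε (R i) K}

theorem combPot_congr {P : StarPotential R ρ D M ε B} (s : CombState A D) {p q : X → ℝ}
    (h : ∀ i, ∀ x ∈ S i, p x = q x) : combPot P s p = combPot P s q := by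
  have h1 : ∀ i, ∑ x ∈ S i, p x = ∑ x ∈ S i, q x := fun i => Finset.sum_congr rfl (h i)
  have h2 : ∀ i, (A i).pot (s.1 i) p = (A i).pot (s.1 i) q :=
    fun i => (A i).pot_congr _ _ _ (h i)
  simp only [combPot, excess, h1, h2]

theorem combPot_zero {P : StarPotential R ρ D M ε B} (s : CombState A D) :
    combPot P s 0 = 0 := by
  simp [combPot, excess, pot_zero]

theorem sum_mass_add_single {T : Finset X} {idx : X → ι} (hT : EquidistantParts T S idx D)
    (p : X → ℝ) {x : X} (hx : x ∈ T) (a : ℝ) :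
    ∑ i, ∑ z ∈ S i, (p + (Pi.single x a : X → ℝ)) z = ∑ i, ∑ z ∈ S i, p z + a := by
  rw [← hT.sum_eq, ← hT.sum_eq, sum_add_single, if_pos hx]

theorem combPot_move {T : Finset X} {idx : X → ι} (hT : EquidistantParts T S idx D)
    {P : StarPotential R ρ D M ε B} (hM : 0 ≤ M) (hMD : M + 2 * K ≤ D) (s : CombState A D)
    {p : X → ℝ} (hp : ∀ x, 0 ≤ p x) {x y : X} (hx : x ∈ T) (hy : y ∈ T) {a : ℝ} (ha : 0 ≤ a) :
    combPot P s (p + (Pi.single y a : X → ℝ)) - combPot P s (p + (Pi.single x a : X → ℝ)) ≤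
      a * dist x y := by
  unfold combPot
  rw [sum_mass_add_single hT p hx, sum_mass_add_single hT p hy]
  by_cases hxy : idx x = idx y
  · have hms : ∀ i, ∑ z ∈ S i, (p + (Pi.single y a : X → ℝ)) z =
        ∑ z ∈ S i, (p + (Pi.single x a : X → ℝ)) z := by
      intro i
      simp only [sum_add_single, mem_parts_iff hT hx, mem_parts_iff hT hy, hxy]
    have hex : excess S (P.prob (levels s)) (p + (Pi.single y a : X → ℝ)) =
        excess S (P.prob (levels s)) (p + (Pi.single x a : X → ℝ)) := by
      simp only [excess, hms]
    rw [hex, sum_pot_add_single hT _ _ x, sum_pot_add_single hT _ _ y]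
    have hy' := hT.mem_idx y hy
    rw [← hxy] at hy'
    have := (A (idx x)).pot_move (s.1 (idx x)) p hp x (hT.mem_idx x hx) y hy' a ha
    rw [← hxy]
    linarith
  · rw [sum_pot_add_single hT _ _ x, sum_pot_add_single hT _ _ y, hT.dist_eq x hx y hy hxy]
    -- Between different parts, two child potentials change by at most `a * K` each and the excess
    -- term by at most `a * M`, which together fit into `a * D`.
    have h1 := abs_le.1 ((A (idx x)).pot_add (s.1 (idx x)) p hp x (hT.mem_idx x hx) a ha)
    have h2 := abs_le.1 ((A (idx y)).pot_add (s.1 (idx y)) p hp y (hT.mem_idx y hy) a ha)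
    have h3 := mul_le_mul_of_nonneg_left (excess_move hT (P.prob (levels s)) p hx hy ha) hM
    have h4 := mul_le_mul_of_nonneg_left hMD ha
    nlinarith [h1.1, h1.2, h2.1, h2.2]

theorem spread_levels (s : CombState A D) (i j : ι) :
    levels s i ≤ levels s j + (D + ε) := s.2 i j

theorem prob_le_one (P : StarPotential R ρ D M ε B) (s : CombState A D) (i : ι) :
    P.prob (levels s) i ≤ 1 := by
  rw [← P.sum_prob (levels s)]
  exact Finset.single_le_sum (fun j _ => (P.prob_pos _ (spread_levels s) j).le) (Finset.mem_univ i)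

theorem combPot_add {T : Finset X} {idx : X → ι} (hT : EquidistantParts T S idx D)
    {P : StarPotential R ρ D M ε B} (hM : 0 ≤ M) (s : CombState A D)
    {p : X → ℝ} (hp : ∀ x, 0 ≤ p x) {x : X} (hx : x ∈ T) {a : ℝ} (ha : 0 ≤ a) :
    |combPot P s (p + (Pi.single x a : X → ℝ)) - combPot P s p| ≤ a * (K + B + M) := by
  unfold combPot
  rw [sum_mass_add_single hT p hx, sum_pot_add_single hT _ _ x]
  have h1 := abs_le.1 ((A (idx x)).pot_add (s.1 (idx x)) p hp x (hT.mem_idx x hx) a ha)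
  have h2 := abs_le.1 (excess_add_single hT (fun i => (P.prob_pos _ (spread_levels s) i).le)
    (prob_le_one P s) p hx ha)
  have h3 := abs_le.1 (P.abs_val_le (levels s) (spread_levels s))
  have h4 := mul_le_mul_of_nonneg_left h2.1 hM
  have h5 := mul_le_mul_of_nonneg_left h2.2 hM
  have h6 := mul_le_mul_of_nonneg_left h3.1 ha
  have h7 := mul_le_mul_of_nonneg_left h3.2 ha
  rw [abs_le]
  constructor <;> nlinarith [h1.1, h1.2]

/-- The points evacuated by a combination. -/
def combEvac (idx : X → ι) (s : CombState A D) : Set X :=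
  {x | Saturated s (idx x) ∨ x ∈ (A (idx x)).evac (s.1 (idx x))}

theorem combSettle_spread (s : CombState A D) (i j : ι) :
    (A i).level (combSettle s i) ≤ (A j).level (combSettle s j) + (D + ε) := by
  rw [level_combSettle, level_combSettle]
  exact s.2 i j

theorem pot_eq_zero_of_forall {S : Finset X} {R : ℝ} (A : Adversary S ε R K) (s : A.State)
    {p : X → ℝ} (h : ∀ x ∈ S, p x = 0) : A.pot s p = 0 :=
  (A.pot_congr s p 0 h).trans (A.pot_zero s)

theorem pot_combSettle {T : Finset X} {idx : X → ι} (hT : EquidistantParts T S idx D)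
    (s : CombState A D) {p : X → ℝ} (hp : ∀ x ∈ T, x ∈ combEvac idx s → p x = 0) (i : ι) :
    (A i).pot (combSettle s i) p = (A i).pot (s.1 i) p := by
  unfold combSettle
  split_ifs with h
  -- A saturated part carries no mass, so the potentials of the discarded and of the fresh state
  -- both vanish.
  · have : ∀ x ∈ S i, p x = 0 := fun x hx =>
      hp x (hT.subset i hx) (Or.inl (by rwa [hT.idx_eq i x hx]))
    rw [pot_eq_zero_of_forall _ _ this, pot_eq_zero_of_forall _ _ this]
  · apply (A i).pot_settle
    intro x hx hx'
    refine hp x (hT.subset i hx) (Or.inr ?_)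
    have := hT.idx_eq i x hx
    subst this
    exact hx'

theorem exists_not_saturated (hD : 0 < D) (s : CombState A D) :
    ∃ i, ¬ Saturated s i ∧ ∀ j, levels s i ≤ levels s j := by
  obtain ⟨i, hi⟩ := Finite.exists_min (levels s)
  exact ⟨i, fun ⟨j, hj⟩ => by linarith [hi j], hi⟩

theorem exists_work_le_of_min {T : Finset X} {idx : X → ι} (hT : EquidistantParts T S idx D)
    (s : CombState A D) {i : ι} (hi : ¬ Saturated s i) :
    ∃ y ∈ T, idx y = i ∧ y ∉ combEvac idx s ∧ (A (idx y)).work (s.1 (idx y)) y ≤ levels s i := by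
  obtain ⟨y, hy, hy', hw⟩ := (A i).exists_work_le (s.1 i)
  have := hT.idx_eq i y hy
  subst this
  exact ⟨y, hT.subset _ hy, rfl, fun h => h.elim hi hy', hw⟩

theorem work_combSettle {T : Finset X} {idx : X → ι} (hT : EquidistantParts T S idx D)
    (hD : 0 < D) (s : CombState A D) {x : X} (hx : x ∈ T) :
    ∃ y ∈ T, y ∉ combEvac idx s ∧ (A (idx y)).work (s.1 (idx y)) y + dist y x ≤
      (A (idx x)).work (combSettle s (idx x)) x := by
  by_cases h : Saturated s (idx x)
  -- A saturated part is entered from a part of minimal level, at least `D` lower and at distance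
  -- exactly `D`.
  · obtain ⟨i, hi, hmin⟩ := exists_not_saturated hD s
    obtain ⟨y, hy, rfl, hy', hw⟩ := exists_work_le_of_min hT s hi
    refine ⟨y, hy, hy', ?_⟩
    have hne : idx y ≠ idx x := fun h' => hi (h' ▸ h)
    rw [hT.dist_eq y hy x hx hne, combSettle, if_pos h, (A _).work_fresh _ _ (hT.mem_idx x hx)]
    obtain ⟨j, hj⟩ := h
    linarith [hmin j]
  · obtain ⟨y, hy, hy', hw⟩ := (A (idx x)).work_settle (s.1 (idx x)) x (hT.mem_idx x hx)
    have hyx := hT.idx_eq _ y hy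
    refine ⟨y, hT.subset _ hy, ?_, ?_⟩
    · unfold combEvac
      rw [Set.mem_ofPred_eq, hyx]
      exact fun h' => h'.elim h hy'
    · rw [hyx, combSettle, if_neg h]
      exact hw

/-- The excesses sum to zero because `P.prob` sums to one, so the largest is nonnegative. A
saturated part is empty while its prescribed probability is positive, so it cannot attain the
maximum unless the total mass is zero. -/
theorem exists_excess_eq (hD : 0 < D) {T : Finset X} {idx : X → ι}
    (hT : EquidistantParts T S idx D) (P : StarPotential R ρ D M ε B) (s : CombState A D)
    {p : X → ℝ} (hp : ∀ x, 0 ≤ p x) (hp' : ∀ x ∈ T, x ∈ combEvac idx s → p x = 0) :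
    ∃ i, ¬ Saturated s i ∧ 0 ≤ excess S (P.prob (levels s)) p ∧
      excess S (P.prob (levels s)) p =
        ∑ x ∈ S i, p x - (∑ j, ∑ x ∈ S j, p x) * P.prob (levels s) i := by
  have hm0 : ∀ i, 0 ≤ ∑ x ∈ S i, p x := fun i => Finset.sum_nonneg fun x _ => hp x
  rcases (Finset.sum_nonneg fun i _ => hm0 i : 0 ≤ ∑ j, ∑ x ∈ S j, p x).eq_or_lt with hm | hm
  · have hmi : ∀ i, ∑ x ∈ S i, p x = 0 := fun i =>
      (Finset.sum_eq_zero_iff_of_nonneg fun i _ => hm0 i).1 hm.symm i (Finset.mem_univ i)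
    obtain ⟨i, hi, -⟩ := exists_not_saturated hD s
    refine ⟨i, hi, ?_⟩
    simp [excess, hmi]
  · obtain ⟨i, -, hi⟩ := Finset.exists_mem_eq_sup' Finset.univ_nonempty
      fun i => ∑ x ∈ S i, p x - (∑ j, ∑ x ∈ S j, p x) * P.prob (levels s) i
    have hnn : 0 ≤ excess S (P.prob (levels s)) p := by
      by_contra! hneg
      have : ∀ i ∈ Finset.univ,
          ∑ x ∈ S i, p x - (∑ j, ∑ x ∈ S j, p x) * P.prob (levels s) i < 0 := fun i _ =>
        (Finset.le_sup' (fun i => ∑ x ∈ S i, p x - (∑ j, ∑ x ∈ S j, p x) * P.prob (levels s) i)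
          (Finset.mem_univ i)).trans_lt hneg
      have := Finset.sum_lt_sum_of_nonempty (Finset.univ_nonempty (α := ι)) this
      rw [Finset.sum_sub_distrib, ← Finset.mul_sum, P.sum_prob] at this
      simp at this
    refine ⟨i, fun hsat => ?_, hnn, hi⟩
    have hz : ∑ x ∈ S i, p x = 0 := Finset.sum_eq_zero fun x hx =>
      hp' x (hT.subset i hx) (Or.inl (by rwa [hT.idx_eq i x hx]))
    have hi' : excess S (P.prob (levels s)) p = _ := hi
    rw [hi', hz] at hnn
    have := mul_pos hm (P.prob_pos _ (spread_levels s) i)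
    linarith

/-- The minimal progress of a combination. -/
noncomputable def combGain (A : ∀ i, Adversary (S i) ε (R i) K) : ℝ :=
  Finset.univ.inf' Finset.univ_nonempty (fun i => (A i).gain) / Fintype.card ι

theorem combGain_pos : 0 < combGain A := by
  have : 0 < Finset.univ.inf' Finset.univ_nonempty (fun i => (A i).gain) :=
    (Finset.lt_inf'_iff _).2 fun i _ => (A i).gain_pos
  exact div_pos this (by exact_mod_cast Fintype.card_pos)

theorem combGain_le (i : ι) : combGain A ≤ (A i).gain / Fintype.card ι := by
  unfold combGain
  gcongr
  exact Finset.inf'_le _ (Finset.mem_univ i)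

theorem exists_comb_step {T : Finset X} {idx : X → ι} (hT : EquidistantParts T S idx D)
    (hD : 0 < D) (hM : 0 ≤ M) (hR : ∀ i, 0 ≤ R i) (P : StarPotential R ρ D M ε B)
    (s : CombState A D) (p : X → ℝ) (hp : ∀ x, 0 ≤ p x)
    (hp' : ∀ x ∈ T, x ∈ combEvac idx s → p x = 0) : ∃ l ∈ T, ∃ s' : CombState A D,
    combGain A ≤ (∑ i, levels s' i) / Fintype.card ι - (∑ i, levels s i) / Fintype.card ι ∧
    (∑ i, levels s' i) / Fintype.card ι - (∑ i, levels s i) / Fintype.card ι ≤ ε ∧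
    ρ * (∑ x ∈ T, p x) *
      ((∑ i, levels s' i) / Fintype.card ι - (∑ i, levels s i) / Fintype.card ι) +
      combPot P s' p - combPot P s p ≤ ε * p l ∧
    ∀ x ∈ T, (A (idx x)).work (combSettle s (idx x)) x + (if x = l then ε else 0) ≤
      (A (idx x)).work (s'.1 (idx x)) x := by
  obtain ⟨i, hi, hnn, hex⟩ := exists_excess_eq hD hT P s hp hp'
  have hci : ∀ x ∈ S i, x ∈ (A i).evac (s.1 i) → p x = 0 := by
    intro x hx hx'
    refine hp' x (hT.subset i hx) (Or.inr ?_)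
    have := hT.idx_eq i x hx
    subst this
    exact hx'
  obtain ⟨l, hl, t, h1, h2, h3, h4⟩ := (A i).step (s.1 i) p hp hci
  have hh : 0 ≤ (A i).level t - (A i).level (s.1 i) := (A i).gain_pos.le.trans h1
  set h := (A i).level t - (A i).level (s.1 i) with hdef
  set f : ∀ j, (A j).State := Function.update (combSettle s) i t with hf
  have hlev : (fun j => (A j).level (f j)) = Function.update (levels s) i (levels s i + h) := by
    ext j
    by_cases hj : j = i
    · subst hj
      simp [hf, hdef, levels]
    · simp [hf, hj, level_combSettle]
  have hle : ∀ j, levels s j ≤ (A j).level (f j) := by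
    intro j
    rw [congrFun hlev j]
    by_cases hj : j = i
    · subst hj; simpa using hh
    · simp [hj]
  have hsat : ∀ j, levels s i < levels s j + D := by
    intro j
    by_contra! h'
    exact hi ⟨j, h'⟩
  let s' : CombState A D := ⟨f, by
    intro j k
    refine le_trans ?_ (add_le_add_left (hle k) _)
    rw [congrFun hlev j]
    by_cases hj : j = i
    · subst hj
      simp only [Function.update_self]
      linarith [hsat k]
    · simpa [hj] using spread_levels s j k⟩
  have hlev' : levels s' = Function.update (levels s) i (levels s i + h) := hlev
  have hsum : ∑ j, levels s' j = ∑ j, levels s j + h := by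
    rw [hlev', Finset.sum_update_of_mem (Finset.mem_univ i),
      ← Finset.add_sum_erase _ _ (Finset.mem_univ i), Finset.sdiff_singleton_eq_erase]
    ring
  have hcard : (1 : ℝ) ≤ Fintype.card ι := by exact_mod_cast Fintype.card_pos
  have hdiff : (∑ j, levels s' j) / Fintype.card ι - (∑ j, levels s j) / Fintype.card ι =
      h / Fintype.card ι := by
    rw [hsum]; ring
  refine ⟨l, hT.subset i hl, s', ?_, ?_, ?_, ?_⟩
  · rw [hdiff]
    refine (combGain_le i).trans ?_
    gcongr
  · rw [hdiff]
    exact (div_le_self hh hcard).trans h2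
  · have hpot : ∑ j, (A j).pot (f j) p = ∑ j, (A j).pot (s.1 j) p +
        ((A i).pot t p - (A i).pot (s.1 i) p) := by
      rw [← sub_eq_iff_eq_add', ← Finset.sum_sub_distrib, Finset.sum_eq_single i]
      · simp [hf]
      · intro j _ hj
        rw [hf, Function.update_of_ne hj, pot_combSettle hT s hp', sub_self]
      · simp
    have hex' : ∑ x ∈ S i, p x - (∑ j, ∑ x ∈ S j, p x) * P.prob (levels s') i ≤
        excess S (P.prob (levels s')) p :=
      Finset.le_sup' (fun i => ∑ x ∈ S i, p x - (∑ j, ∑ x ∈ S j, p x) * P.prob (levels s') i)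
        (Finset.mem_univ i)
    have hv := P.val_sub_le (levels s) (spread_levels s) i h hh h2
    rw [← hlev'] at hv
    have hm0 : 0 ≤ ∑ j, ∑ x ∈ S j, p x :=
      Finset.sum_nonneg fun i _ => Finset.sum_nonneg fun x _ => hp x
    simp only [combPot]
    rw [hT.sum_eq, show s'.1 = f from rfl, hpot]
    set m := ∑ j, ∑ x ∈ S j, p x
    -- The mass of `S i` is at least the prescribed one, so the play in part `i` covers the `R i`
    -- term of `val_sub_le`. Its `M` term cancels against the change of the excess, and `ρ` times
    -- the mean level cancels inside `combPot`.
    have e1 := mul_le_mul_of_nonneg_left hv hm0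
    have e2 := mul_le_mul_of_nonneg_left hex' hM
    have e3 : m * P.prob (levels s) i ≤ ∑ x ∈ S i, p x := by linarith
    have e4 := mul_le_mul_of_nonneg_left e3 (mul_nonneg (hR i) hh)
    rw [hex]
    nlinarith
  · intro x hx
    show _ ≤ (A (idx x)).work (f (idx x)) x
    by_cases hxi : idx x = i
    · have hS : combSettle s i = (A i).settle (s.1 i) := by rw [combSettle, if_neg hi]
      have hxS := hT.mem_idx x hx
      subst hxi
      rw [hf, Function.update_self, hS]
      exact h4 x hxS
    · have hxl : x ≠ l := fun h' => hxi (h' ▸ hT.idx_eq i l hl)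
      rw [hf, Function.update_of_ne hxi, if_neg hxl, add_zero]

/-- Adversaries on parts at mutual distance `D` combine to an adversary on their union. -/
noncomputable def combine {T : Finset X} {idx : X → ι} (hT : EquidistantParts T S idx D)
    (A : ∀ i, Adversary (S i) ε (R i) K) (hε : 0 ≤ ε) (hD : 0 < D) (hM : 0 ≤ M)
    (hMD : M + 2 * K ≤ D) (hR : ∀ i, 0 ≤ R i) (P : StarPotential R ρ D M ε B) :
    Adversary T ε ρ (K + B + M) where
  State := CombState A D
  gain := combGain A
  gain_pos := combGain_pos
  evac := combEvac idx
  level s := (∑ i, levels s i) / Fintype.card ι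
  work s x := (A (idx x)).work (s.1 (idx x)) x
  pot := combPot P
  fresh a := ⟨fun i => (A i).fresh a, fun i j => by
    rw [level_fresh, level_fresh]; linarith⟩
  settle s := ⟨combSettle s, combSettle_spread s⟩
  level_fresh a := by
    simp only [levels, level_fresh, Finset.sum_const, Finset.card_univ, nsmul_eq_mul]
    have : (Fintype.card ι : ℝ) ≠ 0 := by exact_mod_cast Fintype.card_ne_zero
    field_simp
  work_fresh a x hx := (A _).work_fresh a x (hT.mem_idx x hx)
  exists_work_le s := by
    obtain ⟨i, hi, hmin⟩ := exists_not_saturated hD s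
    obtain ⟨y, hy, rfl, hy', hw⟩ := exists_work_le_of_min hT s hi
    refine ⟨y, hy, hy', hw.trans ?_⟩
    have hcard : (0 : ℝ) < Fintype.card ι := by exact_mod_cast Fintype.card_pos
    rw [le_div_iff₀ hcard]
    calc _ = ∑ _i : ι, levels s (idx y) := by simp [mul_comm]
      _ ≤ _ := Finset.sum_le_sum fun j _ => hmin j
  pot_congr s p q h := combPot_congr s fun i x hx => h x (hT.subset i hx)
  pot_zero := combPot_zero
  pot_move s p hp x hx y hy a ha := combPot_move hT hM hMD s hp hx hy ha
  pot_add s p hp x hx a ha := combPot_add hT hM s hp hx ha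
  level_settle s := by
    simp only [levels, level_combSettle]
  pot_settle s p hp := by
    have hl : levels (⟨combSettle s, combSettle_spread s⟩ : CombState A D) = levels s :=
      funext fun i => level_combSettle s i
    simp only [combPot, hl, pot_combSettle hT s hp]
  work_settle s x hx := work_combSettle hT hD s hx
  step s p hp hp' := exists_comb_step hT hD hM hR P s p hp hp'

end combine

end Adversary

/-! ### Star potentials: soft minimum and two unequal points -/

namespace StarPotential

section uniform

variable {ι : Type} [Fintype ι]

/-- The sum of the weights of the points. -/
noncomputable def expSum (c : ℝ) (w : ι → ℝ) : ℝ := ∑ i, Real.exp (-c * w i)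

theorem expSum_pos [Nonempty ι] (c : ℝ) (w : ι → ℝ) : 0 < expSum c w :=
  Finset.sum_pos (fun _ _ => Real.exp_pos _) Finset.univ_nonempty

theorem expSum_update [DecidableEq ι] (c : ℝ) (w : ι → ℝ) (i : ι) (h : ℝ) :
    expSum c (Function.update w i (w i + h)) =
      expSum c w - Real.exp (-c * w i) * (1 - Real.exp (-c * h)) := by
  unfold expSum
  rw [← Finset.add_sum_erase _ _ (Finset.mem_univ i),
    ← Finset.add_sum_erase Finset.univ (fun i => Real.exp (-c * w i)) (Finset.mem_univ i),
    Finset.sum_congr rfl (fun j hj => by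
      rw [Function.update_of_ne (Finset.ne_of_mem_erase hj)] :
      ∀ j ∈ Finset.univ.erase i, Real.exp (-c * Function.update w i (w i + h) j) =
        Real.exp (-c * w j)), Function.update_self, mul_add, Real.exp_add]
  ring

/-- At rate `log b / (2 * D)`, a spread of `2 * D` keeps every weight at least `1 / b` times any
other. The sum is then at least `2 - 1 / b ≥ 3 / 2` times the weight of `i`. -/
theorem exp_le_two_thirds [Nonempty ι] {D : ℝ} (hD : 0 < D) (hb : 2 ≤ Fintype.card ι)
    {w : ι → ℝ} (hw : ∀ i j, w i ≤ w j + 2 * D) (i : ι) :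
    Real.exp (-(Real.log (Fintype.card ι) / (2 * D)) * w i) ≤
      2 / 3 * expSum (Real.log (Fintype.card ι) / (2 * D)) w := by
  classical
  have hb' : (2 : ℝ) ≤ Fintype.card ι := by exact_mod_cast hb
  have hlog : 0 ≤ Real.log (Fintype.card ι) := Real.log_nonneg (by linarith)
  set c := Real.log (Fintype.card ι) / (2 * D) with hc
  have hc0 : 0 ≤ c := by positivity
  have hcD : c * (2 * D) = Real.log (Fintype.card ι) := by rw [hc]; field_simp
  have hj : ∀ j, Real.exp (-c * w i) / Fintype.card ι ≤ Real.exp (-c * w j) := by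
    intro j
    calc Real.exp (-c * w i) / Fintype.card ι
        = Real.exp (-c * w i - Real.log (Fintype.card ι)) := by
          rw [Real.exp_sub, Real.exp_log (by linarith)]
      _ ≤ _ := by
          apply Real.exp_le_exp.2
          have := mul_le_mul_of_nonneg_left (hw j i) hc0
          linarith
  have hsum : Real.exp (-c * w i) + ((Fintype.card ι : ℝ) - 1) *
      (Real.exp (-c * w i) / Fintype.card ι) ≤ expSum c w := by
    unfold expSum
    rw [← Finset.add_sum_erase _ _ (Finset.mem_univ i)]
    gcongr
    calc _ = ∑ j ∈ Finset.univ.erase i, Real.exp (-c * w i) / Fintype.card ι := by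
          rw [Finset.sum_const, Finset.card_erase_of_mem (Finset.mem_univ i), Finset.card_univ,
            nsmul_eq_mul, Nat.cast_sub (by omega), Nat.cast_one]
      _ ≤ _ := Finset.sum_le_sum fun j _ => hj j
  have he := Real.exp_pos (-c * w i)
  have : ((Fintype.card ι : ℝ) - 1) * (Real.exp (-c * w i) / Fintype.card ι) =
      Real.exp (-c * w i) - Real.exp (-c * w i) / Fintype.card ι := by
    field_simp
  have h2 : Real.exp (-c * w i) / Fintype.card ι ≤ Real.exp (-c * w i) / 2 := by gcongr
  linarith

/-- Here `q` is the probability of the raised point and `t` the relative loss of its weight. Up to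
the common factor `q * t / (1 - q * t)`, the `M` term is worth at least `D / 6` since `q ≤ 2 / 3`;
the gain `g` and the error from `r * h` need only `D / 16` each. -/
theorem uniform_inequality {r D M c g h q t : ℝ} (hr : 0 ≤ r) (hD : 0 < D) (hM : D / 2 ≤ M)
    (hc : 0 < c) (hg0 : 0 ≤ g) (hg : g / c ≤ D / 16) (hrh : r * h ≤ D / 16) (hq : 0 ≤ q)
    (hq' : q ≤ 2 / 3) (ht : 0 ≤ t) (ht' : t ≤ c * h) (ht1 : t < 1) :
    -((r + g) / c) * Real.log (1 - q * t) ≤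
      r * q * h + M * (q - q * (1 - t) / (1 - q * t)) := by
  have h0 : 0 ≤ r + g := by linarith
  have hx : 0 < 1 - q * t := by nlinarith
  have hlog : -Real.log (1 - q * t) ≤ q * t / (1 - q * t) := by
    have := Real.one_sub_inv_le_log_of_pos hx
    have e : q * t / (1 - q * t) = (1 - q * t)⁻¹ - 1 := by field_simp; ring
    linarith
  have h1 : -((r + g) / c) * Real.log (1 - q * t) ≤ (r + g) / c * (q * t / (1 - q * t)) := by
    have := mul_le_mul_of_nonneg_left hlog (div_nonneg h0 hc.le)
    linarith
  refine h1.trans ?_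
  have e2 : r * q * h + M * (q - q * (1 - t) / (1 - q * t)) =
      (q * (r * h * (1 - q * t) + M * t * (1 - q))) / (1 - q * t) := by
    field_simp; ring
  have e3 : (r + g) / c * (q * t) = q * ((r * (t / c)) + g / c * t) := by field_simp
  rw [e2, ← mul_div_assoc, e3]
  refine div_le_div_of_nonneg_right (mul_le_mul_of_nonneg_left ?_ hq) hx.le
  have h4 : r * (t / c) ≤ r * h := by
    gcongr
    rwa [div_le_iff₀ hc, mul_comm]
  have h5 : g / c * t ≤ D / 16 * t := by gcongr
  have h6 : r * h * (q * t) ≤ D / 16 * (1 * t) := by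
    gcongr
    linarith
  have h7 : D / 2 * t * (1 / 3) ≤ M * t * (1 - q) :=
    mul_le_mul (mul_le_mul_of_nonneg_right hM ht) (by linarith) (by norm_num)
      (mul_nonneg (by linarith) ht)
  nlinarith [mul_nonneg hD.le ht]

/-- The potential for points with the same cost multiplier: the soft minimum. -/
noncomputable def uniform [DecidableEq ι] [Nonempty ι] {r D M ε : ℝ} (hr : 0 ≤ r) (hD : 0 < D)
    (hb : 2 ≤ Fintype.card ι) (hM : D / 2 ≤ M) (hε : ε * (16 * (r + 1)) ≤ D) :
    StarPotential (fun _ : ι => r) (r + Real.log (Fintype.card ι) / 32) D M ε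
      (2 * D * (r + Real.log (Fintype.card ι) / 32)) where
  val w := -((r + Real.log (Fintype.card ι) / 32) / (Real.log (Fintype.card ι) / (2 * D))) *
    Real.log (expSum (Real.log (Fintype.card ι) / (2 * D)) w / Fintype.card ι)
  prob w i := Real.exp (-(Real.log (Fintype.card ι) / (2 * D)) * w i) /
    expSum (Real.log (Fintype.card ι) / (2 * D)) w
  prob_pos w _ i := div_pos (Real.exp_pos _) (expSum_pos _ _)
  sum_prob w := by
    rw [← Finset.sum_div]
    exact div_self (expSum_pos _ _).ne'
  val_sub_le w hw i h hh hhε := by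
    have hb' : (2 : ℝ) ≤ Fintype.card ι := by exact_mod_cast hb
    have hlog : 0 < Real.log (Fintype.card ι) := Real.log_pos (by linarith)
    have hεD : ε ≤ D := by nlinarith
    have hw2 : ∀ i j, w i ≤ w j + 2 * D := fun i j => (hw i j).trans (by linarith)
    have hq' := exp_le_two_thirds hD hb hw2 i
    set L := Real.log (Fintype.card ι) with hL
    set c := L / (2 * D) with hc
    have hc0 : 0 < c := by positivity
    set Z := expSum c w with hZ
    have hZ0 : 0 < Z := expSum_pos _ _
    set q := Real.exp (-c * w i) / Z with hq
    set t := 1 - Real.exp (-c * h) with ht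
    have ht0 : 0 ≤ t := by
      rw [ht, sub_nonneg, Real.exp_le_one_iff]; nlinarith
    have ht1 : t < 1 := by rw [ht]; linarith [Real.exp_pos (-c * h)]
    have htc : t ≤ c * h := by rw [ht]; linarith [Real.add_one_le_exp (-c * h)]
    have hq0 : 0 ≤ q := by positivity
    have hq23 : q ≤ 2 / 3 := by rw [hq, div_le_iff₀ hZ0]; exact hq'
    have heq : Real.exp (-c * w i) = q * Z := by rw [hq]; field_simp
    have hup : expSum c (Function.update w i (w i + h)) = Z * (1 - q * t) := by
      rw [expSum_update, heq]; ring
    have hx : 0 < 1 - q * t := by nlinarith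
    have key := uniform_inequality (g := L / 32) hr hD hM hc0 (by positivity)
      -- The gain `L / 32` at rate `c = L / (2 * D)` is exactly the allowed `g / c = D / 16`.
      (by rw [hc]; apply le_of_eq; field_simp; norm_num) (by nlinarith) hq0 hq23 ht0 htc ht1
    have e : Real.exp (-c * (w i + h)) / (Z * (1 - q * t)) = q * (1 - t) / (1 - q * t) := by
      rw [mul_add, Real.exp_add, heq, ht, sub_sub_cancel]
      field_simp
    rw [hup, mul_div_right_comm, Real.log_mul (by positivity) hx.ne', Function.update_self, e]
    linarith
  abs_val_le w hw := by
    have hb' : (2 : ℝ) ≤ Fintype.card ι := by exact_mod_cast hb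
    have hlog : 0 < Real.log (Fintype.card ι) := Real.log_pos (by linarith)
    rcases lt_or_ge ε (-D) with hneg | hεD0
    · obtain ⟨i⟩ := ‹Nonempty ι›
      linarith [hw i i]
    have hεD : ε ≤ D := by nlinarith
    obtain ⟨a, ha⟩ := Finite.exists_min w
    have hw2 : ∀ j, w j ≤ w a + 2 * D := fun j => (hw j a).trans (by linarith)
    set L := Real.log (Fintype.card ι) with hL
    set c := L / (2 * D) with hc
    have hc0 : 0 < c := by positivity
    have hcard : (0 : ℝ) < Fintype.card ι := by linarith
    have hρ : 0 ≤ r + L / 32 := by positivity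
    have hZ0 : 0 < expSum c w := expSum_pos _ _
    have a1 : w a ≤ (∑ i, w i) / Fintype.card ι := by
      rw [le_div_iff₀ hcard]
      calc _ = ∑ _i : ι, w a := by simp [mul_comm]
        _ ≤ _ := Finset.sum_le_sum fun j _ => ha j
    have a2 : (∑ i, w i) / Fintype.card ι ≤ w a + 2 * D := by
      rw [div_le_iff₀ hcard]
      calc _ ≤ ∑ _i : ι, (w a + 2 * D) := Finset.sum_le_sum fun j _ => hw2 j
        _ = _ := by rw [Finset.sum_const, Finset.card_univ, nsmul_eq_mul, mul_comm]
    have b1 : Real.log (expSum c w / Fintype.card ι) ≤ -c * w a := by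
      rw [Real.log_le_iff_le_exp (by positivity), div_le_iff₀ hcard]
      calc _ ≤ ∑ _i : ι, Real.exp (-c * w a) := Finset.sum_le_sum fun j _ =>
            Real.exp_le_exp.2 (by nlinarith [ha j])
        _ = _ := by simp [mul_comm]
    have b2 : -c * (w a + 2 * D) ≤ Real.log (expSum c w / Fintype.card ι) := by
      rw [Real.le_log_iff_exp_le (by positivity), le_div_iff₀ hcard]
      calc _ = ∑ _i : ι, Real.exp (-c * (w a + 2 * D)) := by simp [mul_comm]
        _ ≤ _ := Finset.sum_le_sum fun j _ => Real.exp_le_exp.2 (by nlinarith [hw2 j])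
    set l := Real.log (expSum c w / Fintype.card ι)
    set m := (∑ i, w i) / Fintype.card ι
    have e : -((r + L / 32) / c) * l - (r + L / 32) * m = (r + L / 32) * (-l / c - m) := by
      field_simp
    rw [e, abs_mul, abs_of_nonneg hρ, mul_comm]
    gcongr
    have c1 : w a ≤ -l / c := by rw [le_div_iff₀ hc0]; linarith
    have c2 : -l / c ≤ w a + 2 * D := by rw [div_le_iff₀ hc0]; linarith
    rw [abs_le]
    constructor <;> linarith

end uniform

section binary

theorem update_true (w : Bool → ℝ) (h : ℝ) :
    Function.update w true (w true + h) false = w false := by simp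

theorem update_false (w : Bool → ℝ) (h : ℝ) :
    Function.update w false (w false + h) true = w true := by simp

/-- The potential for two points with different cost multipliers. -/
noncomputable def binary {R₁ R₂ D M ε : ℝ} (hR₂ : 0 ≤ R₂) (hR : R₂ ≤ R₁) (hD : 0 < D)
    (hM : D / 2 ≤ M) (hMD : M ≤ D) (hε : ε ≤ D / 2) :
    StarPotential (fun b : Bool => if b then R₁ else R₂)
      (R₁ + Real.exp (-4 * (R₁ - R₂ + 1))) D M ε (D * (2 * R₁ + 2)) where
  -- The exponential is the probability of the point of smaller ratio. The shift by `-2` keeps it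
  -- below one for level differences up to `3 * D / 2`; for differences down to `-2 * D` it is at
  -- least `exp (-4 * (R₁ - R₂ + 1))`, the gain over `R₁`.
  val w := (R₁ + Real.exp (-4 * (R₁ - R₂ + 1))) * w true -
    (R₂ * D / (R₁ - R₂ + 1) + M) * Real.exp ((R₁ - R₂ + 1) * ((w true - w false) / D - 2))
  prob w b := if b then 1 - Real.exp ((R₁ - R₂ + 1) * ((w true - w false) / D - 2))
    else Real.exp ((R₁ - R₂ + 1) * ((w true - w false) / D - 2))
  prob_pos w hw b := by
    have h1 : (w true - w false) / D ≤ 3 / 2 := by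
      rw [div_le_iff₀ hD]; linarith [hw true false]
    cases b
    · simpa using Real.exp_pos _
    · simp only [if_true, sub_pos, Real.exp_lt_one_iff]
      nlinarith
  sum_prob w := by simp
  val_sub_le w hw b h hh hhε := by
    set μ := R₁ - R₂ + 1 with hμ
    have hμ1 : 1 ≤ μ := by linarith
    have hμ0 : 0 < μ := by linarith
    have hz0 := Real.exp_pos (μ * ((w true - w false) / D - 2))
    have hδ : -2 ≤ (w true - w false) / D := by
      rw [le_div_iff₀ hD]; linarith [hw false true]
    have hzg : Real.exp (-4 * μ) ≤ Real.exp (μ * ((w true - w false) / D - 2)) :=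
      Real.exp_le_exp.2 (by nlinarith)
    set z := Real.exp (μ * ((w true - w false) / D - 2)) with hz
    set g := Real.exp (-4 * μ)
    cases b
    -- When the level of `false` rises, the `M` terms agree and `D / μ * (1 - t) ≤ h` settles the
    -- `R₂` term.
    · simp only [Function.update_self, update_false]
      have e : Real.exp (μ * ((w true - (w false + h)) / D - 2)) =
          z * Real.exp (-(μ * h / D)) := by
        rw [hz, ← Real.exp_add]; congr 1; field_simp; ring
      rw [e]
      have ht := Real.add_one_le_exp (-(μ * h / D))
      set t := Real.exp (-(μ * h / D))
      have h1 : D / μ * (1 - t) ≤ h := by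
        rw [div_mul_eq_mul_div, div_le_iff₀ hμ0]
        have : D * (1 - t) ≤ D * (μ * h / D) := by gcongr; linarith
        have e2 : D * (μ * h / D) = h * μ := by field_simp
        linarith
      have h2 := mul_le_mul_of_nonneg_left h1 (mul_nonneg hR₂ hz0.le)
      have e3 : R₂ * D / μ = R₂ * (D / μ) := by ring
      simp only [Bool.false_eq_true, if_false]
      rw [e3]
      linarith
    -- When the level of `true` rises, convexity and `2 * M ≥ D` make the change of the exponential
    -- term worth at least `(R₁ + 1) * z * h`: `R₁ * z * h` replaces the mass missing at `true`, and
    -- `z * h` covers the gain `g * h`.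
    · simp only [Function.update_self, update_true]
      have e : Real.exp (μ * ((w true + h - w false) / D - 2)) = z * Real.exp (μ * h / D) := by
        rw [hz, ← Real.exp_add]; congr 1; field_simp; ring
      rw [e]
      have ht := Real.add_one_le_exp (μ * h / D)
      set t := Real.exp (μ * h / D)
      have hM0 : 0 ≤ M := by linarith
      have ha : 0 ≤ R₂ * D / μ + 2 * M := by positivity
      have h1 : (R₂ * D / μ + 2 * M) * z * (μ * h / D) ≤ (R₂ * D / μ + 2 * M) * z * (t - 1) := by
        gcongr; linarith
      have e2 : (R₂ * D / μ + 2 * M) * z * (μ * h / D) = (R₂ + 2 * M / D * μ) * z * h := by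
        field_simp
      have h3 : 1 ≤ 2 * M / D := by rw [le_div_iff₀ hD]; linarith
      have h4 : (R₁ + 1) * z * h ≤ (R₂ + 2 * M / D * μ) * z * h := by
        have : R₁ + 1 ≤ R₂ + 2 * M / D * μ := by nlinarith
        exact mul_le_mul_of_nonneg_right (mul_le_mul_of_nonneg_right this hz0.le) hh
      have h5 : g * h ≤ z * h := by gcongr
      simp only [if_true]
      linarith
  abs_val_le w hw := by
    set μ := R₁ - R₂ + 1 with hμ
    have hμ1 : 1 ≤ μ := by linarith
    have hz0 := Real.exp_pos (μ * ((w true - w false) / D - 2))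
    have h1 : (w true - w false) / D ≤ 3 / 2 := by
      rw [div_le_iff₀ hD]; linarith [hw true false]
    have hz1 : Real.exp (μ * ((w true - w false) / D - 2)) ≤ 1 :=
      Real.exp_le_one_iff.2 (by nlinarith)
    have hg : Real.exp (-4 * μ) ≤ 1 / 4 := by
      rw [neg_mul, Real.exp_neg, ← one_div]
      apply one_div_le_one_div_of_le (by norm_num)
      linarith [Real.add_one_le_exp (4 * μ)]
    have hg0 := Real.exp_pos (-4 * μ)
    set z := Real.exp (μ * ((w true - w false) / D - 2)) with hz
    set g := Real.exp (-4 * μ)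
    have ha : R₂ * D / μ ≤ R₁ * D := by
      refine (div_le_self (by positivity) hμ1).trans ?_
      gcongr
    have ha0 : 0 ≤ R₂ * D / μ := by positivity
    have hab : |(w true - w false) / 2| ≤ 3 / 4 * D := by
      rw [abs_le]
      constructor <;> linarith [hw true false, hw false true]
    have hR₁ : 0 ≤ R₁ := hR₂.trans hR
    have hab1 : |(R₁ + g) * ((w true - w false) / 2)| ≤ (R₁ + 1 / 4) * (3 / 4 * D) := by
      rw [abs_mul, abs_of_nonneg (by positivity)]
      gcongr
    have hb1 : (R₂ * D / μ + M) * z ≤ (R₁ * D + D) * 1 := by gcongr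
    have hb0 : 0 ≤ (R₂ * D / μ + M) * z := mul_nonneg (by linarith) hz0.le
    simp only [Fintype.sum_bool, Fintype.card_bool, Nat.cast_ofNat]
    have e : (R₁ + g) * w true - (R₂ * D / μ + M) * z - (R₁ + g) * ((w true + w false) / 2) =
      (R₁ + g) * ((w true - w false) / 2) - (R₂ * D / μ + M) * z := by ring
    rw [e]
    have := abs_le.1 hab1
    rw [abs_le]
    constructor <;> nlinarith [mul_nonneg hR₁ hD.le]

end binary

end StarPotential

/-! ### Which parts to combine -/

theorem sum_inv_sq_le_one (n : ℕ) : ∑ i : Fin n, 1 / ((i : ℝ) + 2) ^ 2 ≤ 1 := by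
  rw [Fin.sum_univ_eq_sum_range fun i : ℕ => 1 / ((i : ℝ) + 2) ^ 2]
  suffices h : ∑ i ∈ Finset.range n, 1 / ((i : ℝ) + 2) ^ 2 ≤ 1 - 1 / ((n : ℝ) + 1) by
    have : 0 < 1 / ((n : ℝ) + 1) := by positivity
    linarith
  induction n with
  | zero => simp
  | succ n ih =>
    rw [Finset.sum_range_succ]
    have : 1 / ((n : ℝ) + 2) ^ 2 ≤ 1 / ((n : ℝ) + 1) - 1 / ((n : ℝ) + 2) := by
      rw [div_sub_div _ _ (by positivity) (by positivity), div_le_div_iff₀ (by positivity)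
        (by positivity)]
      nlinarith [(Nat.cast_nonneg n : (0 : ℝ) ≤ n)]
    push_cast
    rw [show (n : ℝ) + 1 + 1 = n + 2 by ring]
    linarith

/-- Either many comparable parts, or the two largest parts, account for the logarithm of the total
size. -/
theorem exists_many_or_two {n : ℕ} {N : Fin (n + 2) → ℝ} (hN : ∀ i, 1 ≤ N i) (hanti : Antitone N) :
    (∃ i : Fin (n + 1), 1 / 128 * Real.log (∑ i, N i) ≤
      1 / 128 * Real.log (N i.succ) + Real.log ((i : ℝ) + 2) / 32) ∨
    1 / 128 * Real.log (∑ i, N i) ≤ 1 / 128 * Real.log (N 0) +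
      Real.exp (-4 * (1 / 128 * Real.log (N 0) - 1 / 128 * Real.log (N 1) + 1)) := by
  rw [or_iff_not_imp_left]
  intro h
  push Not at h
  have hpos : ∀ i, 0 < N i := fun i => one_pos.trans_le (hN i)
  set S := ∑ i, N i with hS
  have hS0 : 0 < S := Finset.sum_pos (fun i _ => hpos i) Finset.univ_nonempty
  -- Failure of the first alternative gives a fourth power, as `1 / 32` is four times `1 / 128`. It
  -- is kept as the square of a summable term.
  have h1 : ∀ i : Fin (n + 1), N i.succ ≤ S * (1 / ((i : ℝ) + 2) ^ 2) ^ 2 := by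
    intro i
    have h2 : (0 : ℝ) < (i : ℝ) + 2 := by positivity
    have h3 : Real.log (N i.succ * ((i : ℝ) + 2) ^ 4) < Real.log S := by
      rw [Real.log_mul (hpos _).ne' (by positivity), Real.log_pow]
      push_cast
      linarith [h i]
    have h4 := (Real.log_lt_log_iff (mul_pos (hpos _) (by positivity)) hS0).1 h3
    rw [div_pow, one_pow, mul_one_div, le_div_iff₀ (by positivity), ← pow_mul]
    exact h4.le
  have hsplit : S = N 0 + ∑ i : Fin (n + 1), N i.succ := by rw [hS, Fin.sum_univ_succ]
  have hq : ∀ i : Fin (n + 1), 1 / ((i : ℝ) + 2) ^ 2 ≤ 1 / 4 := by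
    intro i
    apply one_div_le_one_div_of_le (by norm_num)
    nlinarith [(Nat.cast_nonneg i : (0 : ℝ) ≤ (i : ℕ))]
  have hsum := sum_inv_sq_le_one (n + 1)
  have hS1 : ∑ i : Fin (n + 1), N i.succ ≤ S / 4 := by
    calc ∑ i : Fin (n + 1), N i.succ ≤ ∑ i : Fin (n + 1), S / 4 * (1 / ((i : ℝ) + 2) ^ 2) := by
          refine Finset.sum_le_sum fun i _ => (h1 i).trans ?_
          have : 0 ≤ 1 / ((i : ℝ) + 2) ^ 2 := by positivity
          have := mul_le_mul_of_nonneg_left (mul_le_mul_of_nonneg_right (hq i) this) hS0.le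
          linarith
      _ = S / 4 * ∑ i : Fin (n + 1), 1 / ((i : ℝ) + 2) ^ 2 := by rw [Finset.mul_sum]
      _ ≤ S / 4 := by nlinarith
  -- Each term is bounded by the geometric mean of its bounds `N 1` and `S / (i + 2) ^ 4`.
  have hS2 : ∑ i : Fin (n + 1), N i.succ ≤ √(N 1 * S) := by
    calc ∑ i : Fin (n + 1), N i.succ ≤
          ∑ i : Fin (n + 1), √(N 1 * S) * (1 / ((i : ℝ) + 2) ^ 2) := by
          refine Finset.sum_le_sum fun i _ => ?_
          have h5 : N i.succ ≤ N 1 := hanti (by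
            rw [← Fin.succ_zero_eq_one]; exact Fin.succ_le_succ_iff.2 (Fin.zero_le i))
          have h6 : N i.succ = √(N i.succ * N i.succ) := (Real.sqrt_mul_self (hpos _).le).symm
          rw [h6]
          have h7 : 0 ≤ 1 / ((i : ℝ) + 2) ^ 2 := by positivity
          rw [← Real.sqrt_sq h7, ← Real.sqrt_mul (mul_nonneg (hpos _).le hS0.le)]
          apply Real.sqrt_le_sqrt
          rw [mul_assoc]
          exact mul_le_mul h5 (h1 i) (hpos _).le (hpos _).le
      _ = √(N 1 * S) * ∑ i : Fin (n + 1), 1 / ((i : ℝ) + 2) ^ 2 := (Finset.mul_sum ..).symm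
      _ ≤ √(N 1 * S) := by nlinarith [Real.sqrt_nonneg (N 1 * S)]
  have hSa : S ≤ 4 / 3 * N 0 := by linarith
  set v := N 1 / N 0 with hv
  have hv0 : 0 < v := div_pos (hpos _) (hpos _)
  have hv1 : v ≤ 1 := (div_le_one (hpos _)).2 (hanti (Fin.zero_le _))
  have hN1 : N 1 = v * N 0 := by rw [hv]; field_simp [(hpos 0).ne']
  have hsq : √(N 1 * S) ≤ 2 * N 0 * √v := by
    rw [Real.sqrt_le_left (by have := hpos 0; positivity), mul_pow, Real.sq_sqrt hv0.le, hN1]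
    have := hpos 0
    nlinarith [mul_le_mul_of_nonneg_left hSa (mul_pos hv0 this).le, mul_pos (mul_pos hv0 this) this]
  have hlog : Real.log S - Real.log (N 0) ≤ 2 * √v := by
    rw [← Real.log_div hS0.ne' (hpos 0).ne']
    refine (Real.log_le_sub_one_of_pos (div_pos hS0 (hpos 0))).trans ?_
    rw [sub_le_iff_le_add, div_le_iff₀ (hpos 0)]
    linarith
  -- The gain of the two-part potential is `v ^ (1 / 32) * exp (-4)`, while only `2 * √v / 128` is
  -- needed. As `v ≤ 1`, it remains that `exp 4 ≤ 64`.
  have hexp : Real.exp (-4 * (1 / 128 * Real.log (N 0) - 1 / 128 * Real.log (N 1) + 1)) =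
      Real.exp (1 / 32 * Real.log v) * Real.exp (-4) := by
    rw [← Real.exp_add, hv, Real.log_div (hpos _).ne' (hpos _).ne']
    congr 1; ring
  have hsv : √v ≤ Real.exp (1 / 32 * Real.log v) := by
    have : √v = Real.exp (1 / 2 * Real.log v) := by
      rw [Real.sqrt_eq_rpow, Real.rpow_def_of_pos hv0]; ring_nf
    rw [this]
    apply Real.exp_le_exp.2
    linarith [Real.log_nonpos hv0.le hv1]
  have he4 : (1 : ℝ) / 64 ≤ Real.exp (-4) := by
    rw [Real.exp_neg, ← one_div]
    apply one_div_le_one_div_of_le (Real.exp_pos _)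
    have e1 : Real.exp 4 = Real.exp 1 ^ 4 := by rw [← Real.exp_nat_mul]; norm_num
    have e2 := Real.exp_one_lt_d9
    rw [e1]
    calc Real.exp 1 ^ 4 ≤ 2.8 ^ 4 := by
          gcongr; linarith
      _ ≤ 64 := by norm_num
  rw [hexp]
  have := mul_le_mul hsv he4 (by norm_num) (Real.exp_pos _).le
  linarith

/-! ### Recursion over the tree -/

section HasAdversary

variable {X : Type u} [MetricSpace X] [DecidableEq X]

/-- Some subset of `L` carries adversaries of ratio `R` for all small task sizes. -/
def HasAdversary (L : Finset X) (R K : ℝ) : Prop :=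
  -- A subset, because small parts are abandoned; all small `ε`, because the final bound is reached
  -- only as `ε` tends to zero.
  ∃ S ⊆ L, ∃ ε₀ : ℝ, 0 < ε₀ ∧ ∀ ε, 0 < ε → ε ≤ ε₀ → Nonempty (Adversary S ε R K)

theorem HasAdversary.mono {L L' : Finset X} {R R' K K' : ℝ} (h : HasAdversary L R K)
    (hL : L ⊆ L') (hR : R' ≤ R) (hK : K ≤ K') : HasAdversary L' R' K' := by
  obtain ⟨S, hS, ε₀, h0, hA⟩ := h
  exact ⟨S, hS.trans hL, ε₀, h0, fun ε h1 h2 => (hA ε h1 h2).map fun A => A.mono hR hK⟩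

theorem hasAdversary_singleton (x : X) : HasAdversary {x} 0 0 :=
  ⟨{x}, subset_rfl, 1, one_pos, fun _ h _ => ⟨Adversary.singleton x h⟩⟩

theorem exists_equidistantParts {ι : Type} [Fintype ι] [Nonempty ι] {S : ι → Finset X} {D : ℝ}
    (hD : 0 < D) (h : ∀ i j, i ≠ j → ∀ x ∈ S i, ∀ y ∈ S j, dist x y = D) :
    ∃ idx, EquidistantParts (Finset.univ.biUnion S) S idx D := by
  classical
  have huniq : ∀ i j x, x ∈ S i → x ∈ S j → i = j := by
    intro i j x hi hj
    by_contra hne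
    have := h i j hne x hi x hj
    rw [dist_self] at this
    exact hD.ne this
  refine ⟨fun x => if hx : ∃ i, x ∈ S i then hx.choose else Classical.arbitrary ι, ?_⟩
  have hmem : ∀ x ∈ Finset.univ.biUnion S,
      x ∈ S (if hx : ∃ i, x ∈ S i then hx.choose else Classical.arbitrary ι) := by
    intro x hx
    have hx' : ∃ i, x ∈ S i := by simpa using hx
    rw [dif_pos hx']
    exact hx'.choose_spec
  exact ⟨fun i => Finset.subset_biUnion_of_mem S (Finset.mem_univ i), hmem,
    fun i x hx => huniq _ _ x
      (hmem x (Finset.subset_biUnion_of_mem S (Finset.mem_univ i) hx)) hx,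
    fun x hx y hy hne => h _ _ hne x (hmem x hx) y (hmem y hy)⟩

theorem HasAdversary.combine {ι : Type} [Fintype ι] [DecidableEq ι] [Nonempty ι]
    {L : ι → Finset X} {R : ι → ℝ} {K D ρ B ε₁ : ℝ} (hD : 0 < D) (hK : K ≤ D / 4)
    (hR : ∀ i, 0 ≤ R i) (h : ∀ i j, i ≠ j → ∀ x ∈ L i, ∀ y ∈ L j, dist x y = D) (hε₁ : 0 < ε₁)
    (P : ∀ ε ≤ ε₁, Nonempty (StarPotential R ρ D (D - 2 * K) ε B))
    (hA : ∀ i, HasAdversary (L i) (R i) K) :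
    HasAdversary (Finset.univ.biUnion L) ρ (K + B + (D - 2 * K)) := by
  choose S hS ε₀ h0 A using hA
  obtain ⟨idx, hidx⟩ := exists_equidistantParts hD
    fun i j hij x hx y hy => h i j hij x (hS i hx) y (hS j hy)
  refine ⟨Finset.univ.biUnion S, Finset.biUnion_mono fun i _ => hS i,
    min ε₁ (Finset.univ.inf' Finset.univ_nonempty ε₀),
    lt_min hε₁ ((Finset.lt_inf'_iff _).2 fun i _ => h0 i), fun ε hε hε' => ?_⟩
  obtain ⟨P⟩ := P ε (hε'.trans (min_le_left _ _))
  have hA' : ∀ i, Nonempty (Adversary (S i) ε (R i) K) := fun i =>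
    A i ε hε (hε'.trans ((min_le_right _ _).trans (Finset.inf'_le _ (Finset.mem_univ i))))
  exact ⟨Adversary.combine hidx (fun i => (hA' i).some) hε.le hD (by linarith) (by linarith) hR P⟩

theorem hasAdversary_of_antitone {n : ℕ} {L : Fin (n + 2) → Finset X} {K D Λ : ℝ} (hD : 0 < D)
    (hK0 : 0 ≤ K) (hK : K ≤ D / 4) (hne : ∀ i, (L i).Nonempty)
    (hdist : ∀ i j, i ≠ j → ∀ x ∈ L i, ∀ y ∈ L j, dist x y = D)
    (hanti : Antitone fun i => (L i).card)
    (hΛ : Real.log (Finset.univ.biUnion L).card ≤ Λ)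
    (hA : ∀ i, HasAdversary (L i) (1 / 128 * Real.log (L i).card) K) :
    HasAdversary (Finset.univ.biUnion L) (1 / 128 * Real.log (Finset.univ.biUnion L).card)
      (K + (2 * Λ + 3) * D) := by
  have hdisj : (Finset.univ.biUnion L).card = ∑ i, (L i).card := by
    apply Finset.card_biUnion
    intro i _ j _ hij
    rw [Function.onFun, Finset.disjoint_left]
    intro x hi hj
    have := hdist i j hij x hi x hj
    rw [dist_self] at this
    exact hD.ne this
  have hcard : ((Finset.univ.biUnion L).card : ℝ) = ∑ i, ((L i).card : ℝ) := by
    rw [hdisj]; push_cast; rfl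
  have hN : ∀ i, (1 : ℝ) ≤ (L i).card := fun i => by exact_mod_cast (hne i).card_pos
  have hlog0 : ∀ i, 0 ≤ Real.log (L i).card := fun i => Real.log_nonneg (hN i)
  have hlogle : ∀ i, Real.log (L i).card ≤ Λ := fun i =>
    (Real.log_le_log (by linarith [hN i]) (by
      rw [hcard]
      exact Finset.single_le_sum (f := fun i => ((L i).card : ℝ)) (fun _ _ => Nat.cast_nonneg _)
        (Finset.mem_univ i))).trans hΛ
  have hanti' : Antitone fun i => ((L i).card : ℝ) := fun i j hij =>
    Nat.cast_le.2 (hanti hij)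
  rcases exists_many_or_two hN hanti' with ⟨i, hi⟩ | h2
  · set r := 1 / 128 * Real.log (L i.succ).card with hr
    have hr0 : 0 ≤ r := by have := hlog0 i.succ; positivity
    have hle : (i : ℕ) + 2 ≤ n + 2 := by omega
    -- The smallest of the `i + 2` largest parts dictates the common ratio.
    have hm : ∀ j : Fin (i + 2), HasAdversary (L (Fin.castLE hle j)) r K := by
      intro j
      refine (hA _).mono subset_rfl ?_ le_rfl
      have : (L i.succ).card ≤ (L (Fin.castLE hle j)).card := hanti (by
        rw [Fin.le_def]; simp; omega)
      exact mul_le_mul_of_nonneg_left (Real.log_le_log (by linarith [hN i.succ])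
        (Nat.cast_le.2 this)) (by norm_num)
    have hc := HasAdversary.combine (R := fun _ : Fin (i + 2) => r)
      (ρ := r + Real.log (Fintype.card (Fin (i + 2))) / 32)
      (B := 2 * D * (r + Real.log (Fintype.card (Fin (i + 2))) / 32))
      (ε₁ := D / (16 * (r + 1))) hD hK (fun _ => hr0)
      (fun a b hab => hdist _ _ fun h' => hab (Fin.castLE_injective hle h')) (by positivity)
      (fun ε hε => ⟨StarPotential.uniform hr0 hD (by simp) (by linarith)
        ((le_div_iff₀ (by positivity)).1 hε)⟩) hm
    have hlogi : Real.log ((i : ℝ) + 2) ≤ Λ := by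
      refine le_trans (Real.log_le_log (by positivity) ?_) hΛ
      rw [hcard]
      calc (i : ℝ) + 2 ≤ (n : ℝ) + 2 := by
            have : (i : ℕ) ≤ n := by omega
            have : ((i : ℕ) : ℝ) ≤ n := by exact_mod_cast this
            linarith
        _ = ∑ _i : Fin (n + 2), (1 : ℝ) := by simp
        _ ≤ _ := Finset.sum_le_sum fun j _ => hN j
    simp only [Fintype.card_fin, Nat.cast_add, Nat.cast_ofNat] at hc
    refine hc.mono ?_ ?_ ?_
    · intro x hx
      obtain ⟨j, -, hj⟩ := Finset.mem_biUnion.1 hx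
      exact Finset.mem_biUnion.2 ⟨_, Finset.mem_univ _, hj⟩
    · rw [hcard]; exact hi
    · have h1 : r + Real.log ((i : ℝ) + 2) / 32 ≤ Λ := by
        rw [hr]; linarith [hlogle i.succ, hlog0 i.succ]
      nlinarith
  · set R₁ := 1 / 128 * Real.log (L 0).card with hR₁
    set R₂ := 1 / 128 * Real.log (L 1).card with hR₂
    have hR20 : 0 ≤ R₂ := by have := hlog0 1; positivity
    have hR : R₂ ≤ R₁ :=
      mul_le_mul_of_nonneg_left (Real.log_le_log (by linarith [hN 1])
        (hanti' (Fin.zero_le 1))) (by norm_num)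
    have hc := HasAdversary.combine (L := fun b : Bool => if b then L 0 else L 1)
      (R := fun b : Bool => if b then R₁ else R₂) (ε₁ := D / 2) hD hK
      (by intro b; cases b <;> simp [hR20, hR20.trans hR])
      (by
        intro a b hab x hx y hy
        cases a <;> cases b
        · exact absurd rfl hab
        · exact hdist 1 0 (by simp) x (by simpa using hx) y (by simpa using hy)
        · exact hdist 0 1 (by simp) x (by simpa using hx) y (by simpa using hy)
        · exact absurd rfl hab)
      (by positivity)
      (fun ε hε => ⟨StarPotential.binary hR20 hR hD (by linarith) (by linarith) hε⟩)
      (by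
        intro b
        cases b
        · exact hA 1
        · exact hA 0)
    refine hc.mono ?_ ?_ ?_
    · intro x hx
      obtain ⟨b, -, hb⟩ := Finset.mem_biUnion.1 hx
      cases b
      · exact Finset.mem_biUnion.2 ⟨1, Finset.mem_univ _, by simpa using hb⟩
      · exact Finset.mem_biUnion.2 ⟨0, Finset.mem_univ _, by simpa using hb⟩
    · rw [hcard]; exact h2
    · have h1 : R₁ ≤ Λ := by rw [hR₁]; linarith [hlogle 0, hlog0 0]
      nlinarith

/-- The children are sorted by decreasing size; a single child simply hands on its adversary. -/
theorem hasAdversary_biUnion {κ : Type} [Fintype κ] [Nonempty κ] {L : κ → Finset X}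
    {K D Λ : ℝ} (hD : 0 < D) (hK0 : 0 ≤ K) (hK : K ≤ D / 4) (hne : ∀ i, (L i).Nonempty)
    (hdist : ∀ i j, i ≠ j → ∀ x ∈ L i, ∀ y ∈ L j, dist x y = D)
    (hΛ : Real.log (Finset.univ.biUnion L).card ≤ Λ)
    (hA : ∀ i, HasAdversary (L i) (1 / 128 * Real.log (L i).card) K) :
    HasAdversary (Finset.univ.biUnion L) (1 / 128 * Real.log (Finset.univ.biUnion L).card)
      (K + (2 * Λ + 3) * D) := by
  have hΛ0 : 0 ≤ Λ := (Real.log_natCast_nonneg _).trans hΛ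
  obtain ⟨b, hb⟩ : ∃ b, Fintype.card κ = b + 1 :=
    ⟨_, (Nat.succ_pred_eq_of_pos Fintype.card_pos).symm⟩
  obtain ⟨σ, hanti⟩ : ∃ σ : Fin (b + 1) ≃ κ, Antitone fun i => (L (σ i)).card := by
    let e := (Fintype.equivFinOfCardEq hb).symm
    let f : Fin (b + 1) → ℕᵒᵈ := fun i => OrderDual.toDual (L (e i)).card
    exact ⟨(Tuple.sort f).trans e, fun i j hij => Tuple.monotone_sort f hij⟩
  have hU : Finset.univ.biUnion L = Finset.univ.biUnion fun i => L (σ i) := by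
    ext x
    simp only [Finset.mem_biUnion, Finset.mem_univ, true_and]
    exact ⟨fun ⟨i, hi⟩ => ⟨σ.symm i, by simpa using hi⟩, fun ⟨i, hi⟩ => ⟨_, hi⟩⟩
  rw [hU] at hΛ ⊢
  cases b with
  | zero =>
    have : (Finset.univ.biUnion fun i => L (σ i)) = L (σ 0) := by simp
    rw [this]
    exact (hA (σ 0)).mono subset_rfl le_rfl (by nlinarith)
  | succ n =>
    exact hasAdversary_of_antitone hD hK0 hK (fun i => hne _)
      (fun i j hij => hdist _ _ fun h => hij (σ.injective h)) hanti hΛ fun i => hA _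

end HasAdversary

/-- The leaves below a vertex of a tree. -/
noncomputable def leavesBelow {X : Type u} [Fintype X] {T : RootedTree.{0}}
    (leaf : X → T) (v : T) : Finset X := by
  classical exact Finset.univ.filter fun x => v ≤ leaf x

theorem mem_leavesBelow {X : Type u} [Fintype X] {T : RootedTree.{0}}
    {leaf : X → T} {v : T} {x : X} : x ∈ leavesBelow leaf v ↔ v ≤ leaf x := by
  simp [leavesBelow]

/-- The ancestors of `w` form a chain. -/
theorem covBy_unique {T : RootedTree.{0}} {v a b w : T} (ha : v ⋖ a) (hb : v ⋖ b) (haw : a ≤ w)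
    (hbw : b ≤ w) : a = b := by
  rcases le_total_of_directed haw hbw with h | h
  · exact ((ha.eq_or_eq hb.le h).resolve_left hb.lt.ne').symm
  · exact (hb.eq_or_eq ha.le h).resolve_left ha.lt.ne'

theorem IsHST.hasAdversary {X : Type u} [MetricSpace X] [Fintype X] [DecidableEq X] [Nonempty X]
    {k : ℝ} (h : IsHST k X)
    (hk : 16 * (Real.log (Fintype.card X) + 1) ≤ k) :
    ∃ K, HasAdversary (Finset.univ : Finset X) (1 / 128 * Real.log (Fintype.card X)) K := by
  obtain ⟨T, Δ, leaf, hfin, hΔ0, hΔ, hchild, hdist⟩ := h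
  set Λ := Real.log (Fintype.card X) with hΛ
  have hΛ0 : 0 ≤ Λ := Real.log_natCast_nonneg _
  set lf : X → T := fun x => leaf x with hlf
  -- The bound `4 * (Λ + 1) * Δ v` reproduces itself: for a child it is at most `Δ v / 4` by the
  -- choice of `k`, and combining adds `(2 * Λ + 3) * Δ v`.
  suffices H : ∀ v : T, HasAdversary (leavesBelow lf v)
      (1 / 128 * Real.log (leavesBelow lf v).card) (4 * (Λ + 1) * Δ v) by
    have h0 := H ⊥
    have : leavesBelow lf ⊥ = Finset.univ := by ext x; simp [mem_leavesBelow]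
    rw [this] at h0
    exact ⟨_, h0⟩
  intro v
  induction v using WellFoundedGT.induction with
  | ind v ih =>
  by_cases hv : IsMax v
  · obtain ⟨x, hx⟩ := leaf.surjective ⟨v, hv⟩
    have hx' : lf x = v := by rw [hlf]; simp [hx]
    have : leavesBelow lf v = {x} := by
      ext y
      rw [mem_leavesBelow, Finset.mem_singleton]
      constructor
      · intro hy
        apply leaf.injective
        rw [hx]
        exact Subtype.ext (hv.eq_of_le hy).symm
      · rintro rfl
        exact hx'.ge
    rw [this]
    exact (hasAdversary_singleton x).mono (Finset.Subset.refl _) (by simp) (by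
      have := hΔ0 v; positivity)
  · have hD : 0 < Δ v := (hΔ0 v).lt_of_ne fun h0 => hv ((hΔ v).1 h0.symm)
    let κ : Type := {u : T // v ⋖ u}
    have : Fintype κ := Fintype.ofFinite κ
    have hlt : ∀ x ∈ leavesBelow lf v, v < lf x := by
      intro x hx
      refine (mem_leavesBelow.1 hx).lt_of_ne fun h' => hv ?_
      rw [h']
      exact (leaf x).2
    have hU : leavesBelow lf v = Finset.univ.biUnion fun u : κ => leavesBelow lf u.1 := by
      ext x
      simp only [Finset.mem_biUnion, Finset.mem_univ, true_and]
      constructor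
      · intro hx
        obtain ⟨u, hu, hux⟩ := exists_covBy_le_of_lt (hlt x hx)
        exact ⟨⟨u, hu⟩, mem_leavesBelow.2 hux⟩
      · rintro ⟨u, hu⟩
        exact mem_leavesBelow.2 (u.2.le.trans (mem_leavesBelow.1 hu))
    have hne : ∀ u : T, (leavesBelow lf u).Nonempty := by
      intro u
      obtain ⟨w, huw, hw⟩ := Finite.exists_le_maximal (p := fun _ : T => True) (a := u) trivial
      have hw' : IsMax w := fun z hz => hw.2 trivial hz
      obtain ⟨x, hx⟩ := leaf.surjective ⟨w, hw'⟩
      exact ⟨x, mem_leavesBelow.2 (by rw [hlf]; simpa [hx] using huw)⟩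
    have : Nonempty κ := by
      obtain ⟨x, hx⟩ := hne v
      obtain ⟨u, hu, -⟩ := exists_covBy_le_of_lt (hlt x hx)
      exact ⟨⟨u, hu⟩⟩
    have hk0 : 0 < k := by linarith
    have hc : ∀ u : κ, 4 * (Λ + 1) * Δ u.1 ≤ Δ v / 4 := by
      intro u
      have h1 := hchild v u.1 u.2
      rw [le_div_iff₀ hk0] at h1
      have h2 := mul_le_mul_of_nonneg_left hk (hΔ0 u.1)
      linarith
    have hA : ∀ u : κ, HasAdversary (leavesBelow lf u.1)
        (1 / 128 * Real.log (leavesBelow lf u.1).card) (Δ v / 4) := fun u =>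
      (ih u.1 u.2.lt).mono (Finset.Subset.refl _) le_rfl (hc u)
    have hbound : Δ v / 4 + (2 * Λ + 3) * Δ v ≤ 4 * (Λ + 1) * Δ v := by nlinarith
    have hd : ∀ a b : κ, a ≠ b → ∀ x ∈ leavesBelow lf a.1, ∀ y ∈ leavesBelow lf b.1,
        dist x y = Δ v := by
      intro a b hab x hx y hy
      rw [hdist]
      congr 1
      have hax := mem_leavesBelow.1 hx
      have hby := mem_leavesBelow.1 hy
      have hle : v ≤ lf x ⊓ lf y := le_inf (a.2.le.trans hax) (b.2.le.trans hby)
      -- Otherwise the child of `v` towards the common ancestor would equal both `a` and `b`.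
      refine (hle.eq_of_not_lt fun hlt' => hab ?_).symm
      obtain ⟨u, hu, hux⟩ := exists_covBy_le_of_lt hlt'
      have e1 := covBy_unique hu a.2 (hux.trans inf_le_left) hax
      have e2 := covBy_unique hu b.2 (hux.trans inf_le_right) hby
      exact Subtype.ext (e1.symm.trans e2)
    have hl : Real.log (Finset.univ.biUnion fun u : κ => leavesBelow lf u.1).card ≤ Λ := by
      rw [← hU]
      exact Real.log_le_log (by exact_mod_cast (hne v).card_pos)
        (by exact_mod_cast Finset.card_le_univ _)
    have hB := hasAdversary_biUnion hD (by positivity) le_rfl (fun u : κ => hne u.1) hd hl hA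
    rw [← hU] at hB
    exact hB.mono (Finset.Subset.refl _) le_rfl hbound

/-! ### Schedules and the offline cost -/

section serviceCost

variable {X : Type u} [MetricSpace X]

theorem serviceCost_eq_sum_range (σ : List (MTSTask X)) (s : ℕ → X) :
    serviceCost σ s = ∑ i ∈ Finset.range σ.length,
      (edist (s i) (s (i + 1)) + σ.getD i 0 (s (i + 1))) := by
  rw [serviceCost, ← Fin.sum_univ_eq_sum_range
    fun i => edist (s i) (s (i + 1)) + σ.getD i 0 (s (i + 1))]
  refine Finset.sum_congr rfl fun i _ => ?_
  rw [List.getD_eq_getElem _ _ i.2]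
  rfl

theorem serviceCost_congr (σ : List (MTSTask X)) {s s' : ℕ → X}
    (h : ∀ i ≤ σ.length, s i = s' i) : serviceCost σ s = serviceCost σ s' := by
  rw [serviceCost_eq_sum_range, serviceCost_eq_sum_range]
  refine Finset.sum_congr rfl fun i hi => ?_
  have hi' := Finset.mem_range.1 hi
  rw [h i hi'.le, h (i + 1) hi']

theorem serviceCost_append (σ : List (MTSTask X)) (τ : MTSTask X) (s : ℕ → X) :
    serviceCost (σ ++ [τ]) s = serviceCost σ s +
      (edist (s σ.length) (s (σ.length + 1)) + τ (s (σ.length + 1))) := by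
  rw [serviceCost_eq_sum_range, serviceCost_eq_sum_range, List.length_append,
    List.length_singleton, Finset.sum_range_succ]
  congr 1
  · refine Finset.sum_congr rfl fun i hi => ?_
    rw [List.getD_append _ _ _ _ (Finset.mem_range.1 hi)]
  · rw [List.getD_append_right _ _ _ _ le_rfl]
    simp

/-- Some schedule serving `σ` from `x₀` ends in `x` and costs at most `a`. -/
def Reachable (x₀ : X) (σ : List (MTSTask X)) (x : X) (a : ℝ) : Prop :=
  0 ≤ a ∧ ∃ s : ℕ → X, s 0 = x₀ ∧ s σ.length = x ∧ serviceCost σ s ≤ ENNReal.ofReal a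

variable {x₀ : X} {σ : List (MTSTask X)}

theorem reachable_nil : Reachable x₀ [] x₀ 0 :=
  ⟨le_rfl, fun _ => x₀, rfl, rfl, by simp [serviceCost]⟩

theorem Reachable.mono {x : X} {a b : ℝ} (h : Reachable x₀ σ x a) (hab : a ≤ b) :
    Reachable x₀ σ x b := by
  obtain ⟨h0, s, h1, h2, h3⟩ := h
  exact ⟨h0.trans hab, s, h1, h2, h3.trans (ENNReal.ofReal_le_ofReal hab)⟩

theorem Reachable.append {y x : X} {a t : ℝ} (h : Reachable x₀ σ y a) (τ : MTSTask X)
    (ht : 0 ≤ t) (hτ : τ x ≤ ENNReal.ofReal t) :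
    Reachable x₀ (σ ++ [τ]) x (a + dist y x + t) := by
  obtain ⟨h0, s, h1, h2, h3⟩ := h
  refine ⟨by positivity, fun i => if i ≤ σ.length then s i else x, by simpa using h1,
    by simp, ?_⟩
  rw [serviceCost_append, serviceCost_congr σ (s' := s) fun i hi => by simp [hi],
    add_assoc a, ENNReal.ofReal_add h0 (by positivity), ENNReal.ofReal_add dist_nonneg ht]
  simp only [le_refl, if_true, h2, Nat.not_succ_le_self, if_false]
  rw [edist_dist]
  gcongr

theorem Reachable.optCost_le {x : X} {a : ℝ} (h : Reachable x₀ σ x a) :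
    optCost x₀ σ ≤ ENNReal.ofReal a := by
  obtain ⟨-, s, h1, -, h3⟩ := h
  exact (iInf₂_le s h1).trans h3

end serviceCost

/-! ### Expected cost of a randomized algorithm -/

namespace RandomizedOnlineAlgorithm

open MeasureTheory

variable {X : Type u} [MetricSpace X] {x₀ : X}

/-- The probability of occupying `x` after the tasks `σ`. -/
noncomputable def prob (A : RandomizedOnlineAlgorithm.{u, v} X x₀) (σ : List (MTSTask X)) (x : X) :
    ℝ := A.μ.real {ω | A.state ω σ = x}

/-- The joint distribution of the states occupied after two task sequences. -/
noncomputable def joint (A : RandomizedOnlineAlgorithm.{u, v} X x₀) (σ σ' : List (MTSTask X))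
    (x y : X) : ℝ := A.μ.real ({ω | A.state ω σ = x} ∩ {ω | A.state ω σ' = y})

theorem prob_nonneg (A : RandomizedOnlineAlgorithm.{u, v} X x₀) (σ : List (MTSTask X)) (x : X) :
    0 ≤ A.prob σ x := measureReal_nonneg

theorem joint_nonneg (A : RandomizedOnlineAlgorithm.{u, v} X x₀) (σ σ' : List (MTSTask X))
    (x y : X) : 0 ≤ A.joint σ σ' x y := measureReal_nonneg

variable [Fintype X]

theorem measureReal_eq_sum (A : RandomizedOnlineAlgorithm.{u, v} X x₀) (σ : List (MTSTask X))
    (E : Set A.Ω) :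
    A.μ.real E = ∑ y, A.μ.real (E ∩ {ω | A.state ω σ = y}) := by
  classical
  have h := measureReal_biUnion_finset (μ := A.μ.restrict E) (s := Finset.univ)
    (f := fun y => {ω | A.state ω σ = y}) (by
      intro y _ z _ hyz
      rw [Function.onFun, Set.disjoint_left]
      exact fun ω h1 h2 => hyz (h1.symm.trans h2)) fun y _ => A.measurableSet_state σ y
  have hU : (⋃ y ∈ (Finset.univ : Finset X), {ω | A.state ω σ = y}) = Set.univ := by
    ext ω; simp
  rw [hU, measureReal_restrict_apply MeasurableSet.univ, Set.univ_inter] at h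
  rw [h]
  refine Finset.sum_congr rfl fun y _ => ?_
  rw [measureReal_restrict_apply (A.measurableSet_state σ y), Set.inter_comm]

theorem sum_joint_right (A : RandomizedOnlineAlgorithm.{u, v} X x₀) (σ σ' : List (MTSTask X))
    (x : X) : ∑ y, A.joint σ σ' x y = A.prob σ x :=
  (A.measureReal_eq_sum σ' _).symm

theorem sum_joint_left (A : RandomizedOnlineAlgorithm.{u, v} X x₀) (σ σ' : List (MTSTask X))
    (y : X) : ∑ x, A.joint σ σ' x y = A.prob σ' y := by
  rw [prob, A.measureReal_eq_sum σ]
  exact Finset.sum_congr rfl fun x _ => by rw [joint, Set.inter_comm]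

theorem sum_prob (A : RandomizedOnlineAlgorithm.{u, v} X x₀) (σ : List (MTSTask X)) :
    ∑ x, A.prob σ x = 1 := by
  have := A.measureReal_eq_sum σ Set.univ
  simp only [Set.univ_inter] at this
  rw [← probReal_univ (μ := A.μ), this]
  rfl

/-- The expected distance moved in a step. -/
noncomputable def moveCost (A : RandomizedOnlineAlgorithm.{u, v} X x₀)
    (σ σ' : List (MTSTask X)) : ℝ := ∑ q : X × X, A.joint σ σ' q.1 q.2 * dist q.1 q.2

theorem moveCost_nonneg (A : RandomizedOnlineAlgorithm.{u, v} X x₀) (σ σ' : List (MTSTask X)) :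
    0 ≤ A.moveCost σ σ' :=
  Finset.sum_nonneg fun _ _ => mul_nonneg (A.joint_nonneg _ _ _ _) dist_nonneg

theorem lintegral_edist (A : RandomizedOnlineAlgorithm.{u, v} X x₀) (σ σ' : List (MTSTask X)) :
    ∫⁻ ω, edist (A.state ω σ) (A.state ω σ') ∂A.μ = ENNReal.ofReal (A.moveCost σ σ') := by
  classical
  have h : ∀ ω, edist (A.state ω σ) (A.state ω σ') = ∑ q : X × X,
      ({ω | A.state ω σ = q.1} ∩ {ω | A.state ω σ' = q.2}).indicator
        (fun _ => ENNReal.ofReal (dist q.1 q.2)) ω := by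
    intro ω
    rw [Finset.sum_eq_single (A.state ω σ, A.state ω σ')]
    · have : ω ∈ {ω' | A.state ω' σ = A.state ω σ} ∩ {ω' | A.state ω' σ' = A.state ω σ'} :=
        ⟨rfl, rfl⟩
      rw [Set.indicator_of_mem this, edist_dist]
    · rintro ⟨x, y⟩ - hne
      apply Set.indicator_of_notMem
      rintro ⟨h1, h2⟩
      exact hne (Prod.ext h1.symm h2.symm)
    · simp
  have hm : ∀ q : X × X, MeasurableSet ({ω | A.state ω σ = q.1} ∩ {ω | A.state ω σ' = q.2}) :=
    fun q => (A.measurableSet_state σ q.1).inter (A.measurableSet_state σ' q.2)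
  simp_rw [h]
  rw [lintegral_finsetSum _ fun q _ => measurable_const.indicator (hm q), moveCost,
    ENNReal.ofReal_sum_of_nonneg fun q _ => mul_nonneg (A.joint_nonneg _ _ _ _) dist_nonneg]
  refine Finset.sum_congr rfl fun q _ => ?_
  rw [lintegral_indicator_const (hm q), ENNReal.ofReal_mul (A.joint_nonneg _ _ _ _), joint,
    ofReal_measureReal, mul_comm]

theorem lintegral_task_ge (A : RandomizedOnlineAlgorithm.{u, v} X x₀) (σ : List (MTSTask X))
    (τ : MTSTask X) (x : X) :
    τ x * A.μ {ω | A.state ω σ = x} ≤ ∫⁻ ω, τ (A.state ω σ) ∂A.μ := by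
  rw [← lintegral_indicator_const (A.measurableSet_state σ x)]
  refine lintegral_mono fun ω => ?_
  by_cases h : A.state ω σ = x
  · rw [Set.indicator_of_mem (by exact h), h]
  · rw [Set.indicator_of_notMem (by exact h)]
    exact zero_le

/-- Only a lower bound is needed, and superadditivity of the lower integral requires no
measurability. -/
theorem expectedCost_append (A : RandomizedOnlineAlgorithm.{u, v} X x₀) (σ : List (MTSTask X))
    (τ : MTSTask X) : A.expectedCost σ + (ENNReal.ofReal (A.moveCost σ (σ ++ [τ])) +
      ∫⁻ ω, τ (A.state ω (σ ++ [τ])) ∂A.μ) ≤ A.expectedCost (σ ++ [τ]) := by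
  rw [← lintegral_edist]
  refine (add_le_add_right (le_lintegral_add _ _) _).trans ((le_lintegral_add _ _).trans ?_)
  refine lintegral_mono fun ω => le_of_eq ?_
  rw [serviceCost_append]
  congr 1
  · apply serviceCost_congr
    intro i hi
    rw [List.take_append_of_le_length hi]
  · have h1 : (σ ++ [τ]).take σ.length = σ := by simp
    have h2 : (σ ++ [τ]).take (σ.length + 1) = σ ++ [τ] := by
      rw [List.take_of_length_le]; simp
    rw [h1, h2]

theorem prob_eq_zero {A : RandomizedOnlineAlgorithm.{u, v} X x₀} {σ : List (MTSTask X)}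
    {τ : MTSTask X} (hfin : A.expectedCost (σ ++ [τ]) ≠ ⊤) {x : X} (hx : τ x = ⊤) :
    A.prob (σ ++ [τ]) x = 0 := by
  have h1 := A.expectedCost_append σ τ
  have h2 := A.lintegral_task_ge (σ ++ [τ]) τ x
  by_contra hne
  have hμ : A.μ {ω | A.state ω (σ ++ [τ]) = x} ≠ 0 := fun h => hne (by simp [prob, Measure.real, h])
  rw [hx, ENNReal.top_mul hμ, top_le_iff] at h2
  rw [h2] at h1
  simp only [add_top, top_le_iff] at h1
  exact hfin h1

theorem toReal_expectedCost_append {A : RandomizedOnlineAlgorithm.{u, v} X x₀}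
    {σ : List (MTSTask X)} {τ : MTSTask X} (hfin : A.expectedCost (σ ++ [τ]) ≠ ⊤) {x : X} {t : ℝ}
    (ht : 0 ≤ t) (hx : ENNReal.ofReal t ≤ τ x) :
    (A.expectedCost σ).toReal + A.moveCost σ (σ ++ [τ]) + t * A.prob (σ ++ [τ]) x ≤
      (A.expectedCost (σ ++ [τ])).toReal := by
  have h1 := A.expectedCost_append σ τ
  have h2 := A.lintegral_task_ge (σ ++ [τ]) τ x
  have hσ : A.expectedCost σ ≠ ⊤ := ne_top_of_le_ne_top hfin (le_self_add.trans h1)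
  have h3 : A.expectedCost σ + (ENNReal.ofReal (A.moveCost σ (σ ++ [τ])) +
      ENNReal.ofReal (t * A.prob (σ ++ [τ]) x)) ≤ A.expectedCost (σ ++ [τ]) := by
    refine le_trans ?_ h1
    gcongr
    refine le_trans ?_ h2
    rw [ENNReal.ofReal_mul ht, prob, ofReal_measureReal]
    gcongr
  have hp := mul_nonneg ht (A.prob_nonneg (σ ++ [τ]) x)
  rw [← ENNReal.ofReal_toReal hσ, ← ENNReal.ofReal_add (A.moveCost_nonneg _ _) hp,
    ← ENNReal.ofReal_add ENNReal.toReal_nonneg (add_nonneg (A.moveCost_nonneg _ _) hp)] at h3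
  have := ENNReal.toReal_mono hfin h3
  rw [ENNReal.toReal_ofReal (by have := A.moveCost_nonneg σ (σ ++ [τ]); positivity)] at this
  linarith

/-- Whatever probability disappears from `x` has travelled at least the minimal distance `δ`. -/
theorem mul_prob_sub_le {A : RandomizedOnlineAlgorithm.{u, v} X x₀} {δ : ℝ}
    (hδ0 : 0 ≤ δ) (hδ : ∀ x y : X, x ≠ y → δ ≤ dist x y) (σ σ' : List (MTSTask X)) (x : X) :
    δ * (A.prob σ x - A.prob σ' x) ≤ A.moveCost σ σ' := by
  classical
  have h1 : A.prob σ x - A.joint σ σ' x x = ∑ y ∈ Finset.univ.erase x, A.joint σ σ' x y := by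
    rw [← A.sum_joint_right σ σ' x, ← Finset.add_sum_erase _ _ (Finset.mem_univ x)]
    ring
  have h2 : A.joint σ σ' x x ≤ A.prob σ' x := by
    rw [← A.sum_joint_left σ σ' x]
    exact Finset.single_le_sum (f := fun y => A.joint σ σ' y x)
      (fun _ _ => A.joint_nonneg _ _ _ _) (Finset.mem_univ x)
  calc δ * (A.prob σ x - A.prob σ' x) ≤ δ * (A.prob σ x - A.joint σ σ' x x) := by gcongr
    _ = ∑ y ∈ Finset.univ.erase x, A.joint σ σ' x y * δ := by
      rw [h1, Finset.mul_sum]; exact Finset.sum_congr rfl fun _ _ => mul_comm _ _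
    _ ≤ ∑ y ∈ Finset.univ.erase x, A.joint σ σ' x y * dist x y :=
      Finset.sum_le_sum fun y hy => mul_le_mul_of_nonneg_left
        (hδ x y (Finset.ne_of_mem_erase hy).symm) (A.joint_nonneg _ _ _ _)
    _ ≤ ∑ y, A.joint σ σ' x y * dist x y :=
      Finset.sum_le_sum_of_subset_of_nonneg (Finset.erase_subset _ _) fun _ _ _ =>
        mul_nonneg (A.joint_nonneg _ _ _ _) dist_nonneg
    _ ≤ A.moveCost σ σ' := by
      rw [moveCost, Fintype.sum_prod_type]
      exact Finset.single_le_sum (f := fun x => ∑ y, A.joint σ σ' x y * dist x y)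
        (fun _ _ => Finset.sum_nonneg fun _ _ =>
          mul_nonneg (A.joint_nonneg _ _ _ _) dist_nonneg) (Finset.mem_univ x)

end RandomizedOnlineAlgorithm

/-! ### Playing an adversary against an algorithm -/

namespace Adversary

variable {X : Type u} [MetricSpace X] [DecidableEq X] {S : Finset X} {ε R K : ℝ}

theorem pot_sum_move (B : Adversary S ε R K) (s : B.State) (Q : Finset (X × X))
    (hQ : ∀ q ∈ Q, q.1 ∈ S ∧ q.2 ∈ S) {a : X × X → ℝ} (ha : ∀ q, 0 ≤ a q) :
    ∀ p : X → ℝ, (∀ x, 0 ≤ p x) →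
    B.pot s (p + ∑ q ∈ Q, (Pi.single q.2 (a q) : X → ℝ)) -
      B.pot s (p + ∑ q ∈ Q, (Pi.single q.1 (a q) : X → ℝ)) ≤ ∑ q ∈ Q, a q * dist q.1 q.2 := by
  induction Q using Finset.induction_on with
  | empty => simp
  | insert q Q hq ih =>
    intro p hp
    rw [Finset.sum_insert hq, Finset.sum_insert hq, Finset.sum_insert hq]
    have hs : ∀ x : X, ∀ q, 0 ≤ (Pi.single x (a q) : X → ℝ) := fun x q => by
      rw [Pi.single_nonneg]; exact ha q
    have h1 := ih (fun q hq => hQ q (Finset.mem_insert_of_mem hq))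
      (p + (Pi.single q.2 (a q) : X → ℝ)) fun x => add_nonneg (hp x) (hs _ q x)
    have h2 := B.pot_move s (p + ∑ q ∈ Q, (Pi.single q.1 (a q) : X → ℝ)) (fun x =>
      add_nonneg (hp x) (by
        rw [Finset.sum_apply]
        exact Finset.sum_nonneg fun q _ => hs _ q x))
      q.1 (hQ q (Finset.mem_insert_self q Q)).1 q.2 (hQ q (Finset.mem_insert_self q Q)).2
      (a q) (ha q)
    rw [add_assoc p, add_assoc p] at h1
    rw [add_right_comm, add_assoc p, add_right_comm, add_assoc p] at h2
    linarith

theorem abs_pot_le (B : Adversary S ε R K) (s : B.State) {p : X → ℝ} (hp : ∀ x, 0 ≤ p x) :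
    |B.pot s p| ≤ (∑ x ∈ S, p x) * K := by
  suffices h : ∀ Q ⊆ S, |B.pot s (∑ x ∈ Q, (Pi.single x (p x) : X → ℝ))| ≤ (∑ x ∈ Q, p x) * K by
    have := h S subset_rfl
    rwa [B.pot_congr s _ p] at this
    intro x hx
    rw [Finset.sum_apply, Finset.sum_pi_single, if_pos hx]
  intro Q
  induction Q using Finset.induction_on with
  | empty => simp [B.pot_zero]
  | insert x Q hx ih =>
    intro hQ
    rw [Finset.sum_insert hx, Finset.sum_insert hx, add_comm]
    have h1 := ih ((Finset.subset_insert _ _).trans hQ)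
    have h2 := B.pot_add s (∑ x ∈ Q, (Pi.single x (p x) : X → ℝ)) (fun y => by
      rw [Finset.sum_apply]
      exact Finset.sum_nonneg fun z _ => by
        have : (0 : X → ℝ) ≤ Pi.single z (p z) := by rw [Pi.single_nonneg]; exact hp z
        exact this y) x (hQ (Finset.mem_insert_self x Q)) (p x) (hp x)
    have h3 := abs_add_le (B.pot s (∑ x ∈ Q, (Pi.single x (p x) : X → ℝ) +
      (Pi.single x (p x) : X → ℝ)) - B.pot s (∑ x ∈ Q, (Pi.single x (p x) : X → ℝ)))
      (B.pot s (∑ x ∈ Q, (Pi.single x (p x) : X → ℝ)))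
    rw [sub_add_cancel] at h3
    linarith

variable [Fintype X] {x₀ : X}

/-- The joint distribution of the two states is a transport plan between their laws, of cost
`moveCost`; its entries are moved one at a time. -/
theorem pot_prob_sub_le (B : Adversary S ε R K) (s : B.State)
    (A : RandomizedOnlineAlgorithm.{u, v} X x₀) {σ σ' : List (MTSTask X)}
    (hσ : ∀ x ∉ S, A.prob σ x = 0) (hσ' : ∀ x ∉ S, A.prob σ' x = 0) :
    B.pot s (A.prob σ') - B.pot s (A.prob σ) ≤ A.moveCost σ σ' := by
  have h0 : ∀ q : X × X, q ∉ S ×ˢ S → A.joint σ σ' q.1 q.2 = 0 := by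
    intro q hq
    apply le_antisymm _ (A.joint_nonneg _ _ _ _)
    rw [Finset.mem_product, not_and_or] at hq
    rcases hq with hq | hq
    · rw [← hσ _ hq, ← A.sum_joint_right σ σ']
      exact Finset.single_le_sum (f := fun y => A.joint σ σ' q.1 y)
        (fun _ _ => A.joint_nonneg _ _ _ _) (Finset.mem_univ q.2)
    · rw [← hσ' _ hq, ← A.sum_joint_left σ σ']
      exact Finset.single_le_sum (f := fun x => A.joint σ σ' x q.2)
        (fun _ _ => A.joint_nonneg _ _ _ _) (Finset.mem_univ q.1)
  have key := B.pot_sum_move s (S ×ˢ S) (fun q hq => Finset.mem_product.1 hq)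
    (a := fun q => A.joint σ σ' q.1 q.2) (fun q => A.joint_nonneg _ _ _ _) 0 fun _ => le_rfl
  have e1 : (0 : X → ℝ) + ∑ q ∈ S ×ˢ S, (Pi.single q.2 (A.joint σ σ' q.1 q.2) : X → ℝ) =
      A.prob σ' := by
    rw [zero_add, Finset.sum_subset (Finset.subset_univ _) fun q _ hq => by
      rw [h0 q hq, Pi.single_zero]]
    ext y
    rw [Finset.sum_apply, Fintype.sum_prod_type, ← A.sum_joint_left σ σ']
    exact Finset.sum_congr rfl fun x _ => by simp [Pi.single_apply]
  have e2 : (0 : X → ℝ) + ∑ q ∈ S ×ˢ S, (Pi.single q.1 (A.joint σ σ' q.1 q.2) : X → ℝ) =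
      A.prob σ := by
    rw [zero_add, Finset.sum_subset (Finset.subset_univ _) fun q _ hq => by
      rw [h0 q hq, Pi.single_zero]]
    ext x
    rw [Finset.sum_apply, Fintype.sum_prod_type_right, ← A.sum_joint_right σ σ']
    exact Finset.sum_congr rfl fun x _ => by simp [Pi.single_apply]
  rw [e1, e2] at key
  refine key.trans (le_of_eq ?_)
  rw [RandomizedOnlineAlgorithm.moveCost]
  exact Finset.sum_subset (Finset.subset_univ _) fun q _ hq => by rw [h0 q hq, zero_mul]

end Adversary

namespace Adversary

variable {X : Type u} [MetricSpace X] [DecidableEq X] [Fintype X] {S : Finset X} {ε R K : ℝ}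
  {x₀ : X}

open Classical in
/-- The task that forbids the points of `E` and all points outside `S`. -/
noncomputable def evacTask (S : Finset X) (E : Set X) : MTSTask X :=
  fun x => if x ∈ S ∧ x ∉ E then 0 else ⊤

/-- The task that charges `ε` at `l` and forbids all points outside `S`. -/
noncomputable def hitTask (S : Finset X) (ε : ℝ) (l : X) : MTSTask X :=
  fun x => if x ∈ S then (if x = l then ENNReal.ofReal ε else 0) else ⊤

/-- The state of the play after some rounds: `B` is in state `s`, all work function values are
bounded by `B.work` up to the constant `a`, and the expected cost is bounded below by means of the
potential. -/
structure PlayInvariant (B : Adversary S ε R K) (A : RandomizedOnlineAlgorithm.{u, v} X x₀)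
    (θ a : ℝ) (σ : List (MTSTask X)) (s : B.State) : Prop where
  reachable : ∀ x ∈ S, Reachable x₀ σ x (B.work s x + a)
  prob_eq_zero : ∀ x ∉ S, A.prob σ x = 0
  -- Subtracting `K` makes the bound trivial at the start; the factor `1 - θ` allows for the
  -- algorithm leaving a charged point once it sees the task.
  cost_le : (1 - θ) * (R * B.level s + B.pot s (A.prob σ) - K) ≤ (A.expectedCost σ).toReal

theorem sum_prob_eq_one (A : RandomizedOnlineAlgorithm.{u, v} X x₀) {σ : List (MTSTask X)}
    (h : ∀ x ∉ S, A.prob σ x = 0) : ∑ x ∈ S, A.prob σ x = 1 := by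
  rw [← A.sum_prob σ]
  exact Finset.sum_subset (Finset.subset_univ _) fun x _ hx => h x hx

theorem playInvariant_fresh (B : Adversary S ε R K) (A : RandomizedOnlineAlgorithm.{u, v} X x₀)
    (hfin : ∀ σ x a, Reachable x₀ σ x a → A.expectedCost σ ≠ ⊤) {θ a : ℝ} (hθ1 : θ ≤ 1)
    (ha : ∀ x, dist x₀ x ≤ a) : PlayInvariant B A θ a [evacTask S ∅] (B.fresh 0) := by
  have hr : ∀ x ∈ S, Reachable x₀ ([] ++ [evacTask S ∅]) x (B.work (B.fresh 0) x + a) := by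
    intro x hx
    refine (reachable_nil.append (x := x) _ le_rfl (by simp [evacTask, hx])).mono ?_
    rw [B.work_fresh 0 x hx]
    linarith [ha x]
  obtain ⟨y, hy, -⟩ := B.exists_work_le (B.fresh 0)
  have hfin' := hfin _ _ _ (hr y hy)
  have h0 : ∀ x ∉ S, A.prob ([] ++ [evacTask S ∅]) x = 0 := fun x hx =>
    RandomizedOnlineAlgorithm.prob_eq_zero hfin' (by simp [evacTask, hx])
  refine ⟨hr, h0, le_trans ?_ ENNReal.toReal_nonneg⟩
  have := B.abs_pot_le (B.fresh 0) (A.prob_nonneg ([] ++ [evacTask S ∅]))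
  rw [sum_prob_eq_one A h0, one_mul] at this
  rw [B.level_fresh]
  exact mul_nonpos_of_nonneg_of_nonpos (by linarith) (by
    have := (abs_le.1 this).2
    rw [List.nil_append] at this
    linarith)

theorem PlayInvariant.round {B : Adversary S ε R K} {A : RandomizedOnlineAlgorithm.{u, v} X x₀}
    (hfin : ∀ σ x a, Reachable x₀ σ x a → A.expectedCost σ ≠ ⊤) {θ a δ : ℝ} (hθ0 : 0 ≤ θ)
    (hθ1 : θ ≤ 1) (hδ0 : 0 ≤ δ) (hδ : ∀ x y : X, x ≠ y → δ ≤ dist x y) (hε : 0 < ε)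
    (hεδ : ε ≤ θ * δ) {σ : List (MTSTask X)} {s : B.State} (h : PlayInvariant B A θ a σ s) :
    ∃ σ' s', PlayInvariant B A θ a σ' s' ∧ B.gain ≤ B.level s' - B.level s := by
  set σ₁ := σ ++ [evacTask S (B.evac s)] with hσ₁
  have hr₁ : ∀ y ∈ S, y ∉ B.evac s → Reachable x₀ σ₁ y (B.work s y + a) := fun y hy hy' =>
    ((h.reachable y hy).append (x := y) _ le_rfl (by simp [evacTask, hy, hy'])).mono (by simp)
  obtain ⟨y, hy, hy', -⟩ := B.exists_work_le s
  have hfin₁ := hfin _ _ _ (hr₁ y hy hy')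
  have h0₁ : ∀ x ∉ S, A.prob σ₁ x = 0 := fun x hx =>
    RandomizedOnlineAlgorithm.prob_eq_zero hfin₁ (by simp [evacTask, hx])
  have hev : ∀ x ∈ S, x ∈ B.evac s → A.prob σ₁ x = 0 := fun x _ hx =>
    RandomizedOnlineAlgorithm.prob_eq_zero hfin₁ (by simp [evacTask, hx])
  -- The charged point depends only on the distribution after the evacuation, so the adversary is
  -- oblivious.
  obtain ⟨l, hl, s', hg, -, hcost, hwork⟩ := B.step s (A.prob σ₁) (A.prob_nonneg σ₁) hev
  rw [sum_prob_eq_one A h0₁, mul_one] at hcost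
  set σ₂ := σ₁ ++ [hitTask S ε l] with hσ₂
  have hr₂ : ∀ x ∈ S, Reachable x₀ σ₂ x (B.work s' x + a) := by
    intro x hx
    obtain ⟨z, hz, hz', hw⟩ := B.work_settle s x hx
    refine ((hr₁ z hz hz').append (x := x) (t := if x = l then ε else 0) _
      (by split_ifs <;> linarith) (by simp only [hitTask, hx, if_true]; split_ifs <;> simp)).mono ?_
    linarith [hwork x hx]
  have hfin₂ := hfin _ _ _ (hr₂ y hy)
  have h0₂ : ∀ x ∉ S, A.prob σ₂ x = 0 := fun x hx =>
    RandomizedOnlineAlgorithm.prob_eq_zero hfin₂ (by simp [hitTask, hx])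
  refine ⟨σ₂, s', ⟨hr₂, h0₂, ?_⟩, hg⟩
  have c₁ := RandomizedOnlineAlgorithm.toReal_expectedCost_append hfin₁ (x := y) le_rfl
    (by simp)
  have c₂ := RandomizedOnlineAlgorithm.toReal_expectedCost_append hfin₂ (x := l) hε.le
    (by simp [hitTask, hl])
  rw [← hσ₁] at c₁
  rw [← hσ₂] at c₂
  have m₁ := B.pot_prob_sub_le s A h.prob_eq_zero h0₁
  have m₂ := B.pot_prob_sub_le s' A h0₁ h0₂
  have n₁ := A.moveCost_nonneg σ σ₁
  have n₂ := A.moveCost_nonneg σ₁ σ₂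
  have p₁ := mul_nonneg hε.le (A.prob_nonneg σ₁ l)
  -- Evading the charge `ε ≤ θ * δ` costs at least `δ` per unit of mass, so at most a fraction `θ`
  -- of the movement cost is saved.
  have hq : ε * (A.prob σ₁ l - A.prob σ₂ l) ≤ θ * A.moveCost σ₁ σ₂ := by
    rcases le_or_gt (A.prob σ₁ l) (A.prob σ₂ l) with hle | hlt
    · exact (mul_nonpos_of_nonneg_of_nonpos hε.le (by linarith)).trans (mul_nonneg hθ0 n₂)
    · calc ε * (A.prob σ₁ l - A.prob σ₂ l) ≤ θ * δ * (A.prob σ₁ l - A.prob σ₂ l) := by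
            exact mul_le_mul_of_nonneg_right hεδ (by linarith)
        _ = θ * (δ * (A.prob σ₁ l - A.prob σ₂ l)) := by ring
        _ ≤ _ := mul_le_mul_of_nonneg_left
            (RandomizedOnlineAlgorithm.mul_prob_sub_le hδ0 hδ σ₁ σ₂ l) hθ0
  have hinv := h.cost_le
  have htot : R * B.level s' + B.pot s' (A.prob σ₂) - K ≤
      (R * B.level s + B.pot s (A.prob σ) - K) +
        (A.moveCost σ σ₁ + A.moveCost σ₁ σ₂ + ε * A.prob σ₁ l) := by linarith
  have := mul_le_mul_of_nonneg_left htot (sub_nonneg.2 hθ1)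
  have k₁ := mul_nonneg hθ0 n₁
  have k₃ := mul_nonneg hθ0 p₁
  linarith

/-- An adversary of ratio `R` bounds the competitive ratio of every randomized online algorithm. -/
theorem _root_.HasAdversary.le_of_isCompetitive {L : Finset X} (h : HasAdversary L R K)
    (A : RandomizedOnlineAlgorithm.{u, v} X x₀) {r : ℝ≥0} (hA : A.IsCompetitive r) : R ≤ r := by
  obtain ⟨c, hc⟩ := hA
  obtain ⟨S, -, ε₀, hε₀, hB⟩ := h
  have hbound : ∀ σ x a, Reachable x₀ σ x a →
      A.expectedCost σ ≤ ENNReal.ofReal (r * a + c) := by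
    intro σ x a hr
    refine (hc σ).trans ?_
    rw [ENNReal.ofReal_add (mul_nonneg r.coe_nonneg hr.1) c.coe_nonneg, ENNReal.ofReal_mul r.coe_nonneg,
      ENNReal.ofReal_coe_nnreal, ENNReal.ofReal_coe_nnreal]
    gcongr
    exact hr.optCost_le
  have hfin : ∀ σ x a, Reachable x₀ σ x a → A.expectedCost σ ≠ ⊤ := fun σ x a hr =>
    ne_top_of_le_ne_top ENNReal.ofReal_ne_top (hbound σ x a hr)
  obtain ⟨δ, hδ0, hδ⟩ : ∃ δ : ℝ, 0 < δ ∧ ∀ x y : X, x ≠ y → δ ≤ dist x y := by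
    refine ⟨Finset.univ.inf' ⟨(x₀, x₀), Finset.mem_univ _⟩
      fun q : X × X => if q.1 = q.2 then 1 else dist q.1 q.2,
      (Finset.lt_inf'_iff _).2 fun q _ => ?_, fun x y hxy => ?_⟩
    · split_ifs with h
      · exact one_pos
      · exact dist_pos.2 h
    · refine (Finset.inf'_le _ (Finset.mem_univ (x, y))).trans_eq ?_
      simp [hxy]
  obtain ⟨a, ha⟩ : ∃ a, ∀ x, dist x₀ x ≤ a :=
    ⟨Finset.univ.sup' ⟨x₀, Finset.mem_univ _⟩ (dist x₀),
      fun x => Finset.le_sup' (dist x₀) (Finset.mem_univ x)⟩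
  have hθ : ∀ θ : ℝ, 0 < θ → θ ≤ 1 → (1 - θ) * R ≤ r := by
    intro θ hθ0 hθ1
    obtain ⟨B⟩ := hB (min ε₀ (θ * δ)) (by positivity) (min_le_left _ _)
    have hplay : ∀ t : ℕ, ∃ σ s, PlayInvariant B A θ a σ s ∧ t * B.gain ≤ B.level s := by
      intro t
      induction t with
      | zero => exact ⟨_, _, playInvariant_fresh B A hfin hθ1 ha, by simp [B.level_fresh]⟩
      | succ t ih =>
        obtain ⟨σ, s, hp, hs⟩ := ih
        obtain ⟨σ', s', hp', hs'⟩ := hp.round hfin hθ0.le hθ1 hδ0.le hδ (by positivity)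
          (min_le_right _ _)
        exact ⟨σ', s', hp', by push_cast; linarith⟩
    by_contra! hlt
    -- The invariant and the competitive bound give `((1 - θ) * R - r) * level ≤ r * a + c + 2 * (1
    -- - θ) * K`, using `pot ≥ -K`; after `t` rounds the level is too large for this.
    obtain ⟨t, ht⟩ := exists_nat_gt ((r * a + c + 2 * (1 - θ) * K) / (((1 - θ) * R - r) * B.gain))
    rw [div_lt_iff₀ (mul_pos (by linarith) B.gain_pos)] at ht
    obtain ⟨σ, s, hp, hs⟩ := hplay t
    obtain ⟨y, hy, -, hw⟩ := B.exists_work_le s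
    have hr := hp.reachable y hy
    have hle := ENNReal.toReal_mono ENNReal.ofReal_ne_top (hbound σ y _ hr)
    rw [ENNReal.toReal_ofReal (add_nonneg (mul_nonneg r.coe_nonneg hr.1) c.coe_nonneg)] at hle
    have hpot := (abs_le.1 (B.abs_pot_le s (A.prob_nonneg σ))).1
    rw [sum_prob_eq_one A hp.prob_eq_zero, one_mul] at hpot
    have h1 := hp.cost_le
    have h2 := mul_le_mul_of_nonneg_left hpot (sub_nonneg.2 hθ1)
    have h3 := mul_le_mul_of_nonneg_left hw r.coe_nonneg
    have h4 := mul_le_mul_of_nonneg_left hs (sub_pos.2 hlt).le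
    nlinarith
  by_contra! hlt
  have hR : 0 < R := lt_of_le_of_lt r.coe_nonneg hlt
  -- With this `θ`, `(1 - θ) * R` is the midpoint of `r` and `R`.
  have hθ' := hθ ((R - r) / (2 * R)) (div_pos (by linarith) (by linarith))
    (by rw [div_le_one (by linarith)]; linarith [r.coe_nonneg])
  have e : (1 - (R - r) / (2 * R)) * R = R - (R - r) / 2 := by field_simp
  rw [e] at hθ'
  linarith

end Adversary

theorem mainTheorem3 :
    ∃ C : ℝ, 0 < C ∧ ∃ c : ℝ, 0 < c ∧
      ∀ (X : Type u) [MetricSpace X] [Fintype X] (k : ℝ), 1 ≤ k →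
        C * Real.log (Fintype.card X) ^ 2 ≤ k → IsHST k X →
          ∀ (x₀ : X) (A : RandomizedOnlineAlgorithm.{u, v} X x₀) (r : ℝ≥0),
            A.IsCompetitive r → c * Real.log (Fintype.card X) ≤ r := by
  refine ⟨100, by norm_num, 1 / 128, by norm_num, ?_⟩
  intro X _ _ k _ hkC hX x₀ A r hA
  classical
  have : Nonempty X := ⟨x₀⟩
  rcases Nat.lt_or_ge 1 (Fintype.card X) with hn | hn
  -- For `log n ≥ 1 / 2`, `100 * log n ^ 2` is at least `16 * (log n + 1)`; a single point is
  -- trivial because its logarithm vanishes.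
  · have hlog : 1 / 2 ≤ Real.log (Fintype.card X) := by
      have h1 : Real.log 2 ≤ Real.log (Fintype.card X) :=
        Real.log_le_log (by norm_num) (by exact_mod_cast hn)
      linarith [Real.log_two_gt_d9]
    obtain ⟨K, hK⟩ := hX.hasAdversary (by nlinarith)
    exact hK.le_of_isCompetitive A hA
  · have : Fintype.card X = 1 := le_antisymm hn Fintype.card_pos
    simp [this]
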